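/- Let $m\ge 2$ be an even integer, let $q$ be an odd prime power, and let $b=q^{m-1}\frac{q^m-1}{q-1}$ be the number of lines of the affine geometry $\mathrm{AG}(m,q)$, whose points are the vectors of $\mathbb{F}_q^m$ and whose lines are the one-dimensional affine subspaces. Let $H$ be the $q^m\times b$ point-by-line incidence matrix of $\mathrm{AG}(m,q)$ over $\mathbb{F}_2$ and let $$H'=\begin{bmatrix} I & H\\ 1\cdots 1 & 0\cdots 0\end{bmatrix}$$ be the $(q^m+1)\times(b+q^m)$ incidence matrix of the extended design, in which a new point $\infty$ and the blocks $\{\infty,p\}$, for all points $p$, are added. An $[[n,k;c]]$ entanglement-assisted quantum code encodes $k$ logical qubits together with the sender's halves of $c$ ebits (pairs of qubits in the state $(|00\rangle+|11\rangle)/\sqrt2$) isometrically into $n$ physical qubits; the receiver's halves of the ebits are noiseless. It is decoded by the binary linear code with parity-check matrix $H'$ if the receiver has a projective measurement on the $n+c$ qubits which, for every encoded state and every Pauli error with bit-error vector $e_X\in\mathbb{F}_2^n$ and phase-error vector $e_Z\in\mathbb{F}_2^n$ on the physical qubits, returns with certainty the pair of syndromes $(H'e_X^T,H'e_Z^T)$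 without changing the corrupted state. Then there is an $[[n,k;1]]$ entanglement-assisted quantum code of length $n=b+q^m$ and dimension $k=b-q^m-1$ that is decoded by the binary linear code with parity-check matrix $H'$. It requires exactly one ebit: there is no such $[[n,k;0]]$ code decoded by this linear code, and $H'H'^T$ has rank $1$ over $\mathbb{F}_2$. The (LDPC) code with parity-check matrix $H'$ has length $b+q^m$, dimension $b-1$ and minimum distance $2q$, and the Tanner graph of $H'$ has girth $6$. -/

import Mathlib

open scoped Classical

noncomputable section

namespace EAQ

/-! ### Binary linear codes given by a parity-check matrix -/

/-- The binary linear code with parity-check matrix `H` (rows: checks, columns: bits). -/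
def code {R N : Type*} [Fintype N] (H : Matrix R N (ZMod 2)) : Submodule (ZMod 2) (N → ZMod 2) :=
  LinearMap.ker H.mulVecLin

/-- `d` is the minimum distance of the linear code `C`: the least Hamming distance between
two distinct codewords. -/
def IsMinDist {N : Type*} [Fintype N] (C : Submodule (ZMod 2) (N → ZMod 2)) (d : ℕ) : Prop :=
  IsLeast {e : ℕ | ∃ x ∈ C, ∃ y ∈ C, x ≠ y ∧ hammingDist x y = e} d

/-- The Tanner graph of a parity-check matrix: the bipartite graph on checks and bits where a
check is joined to the bits that it involves. -/
def tannerGraph {R N : Type*} (H : Matrix R N (ZMod 2)) : SimpleGraph (R ⊕ N) :=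
  SimpleGraph.fromRel fun u v => ∃ r n, u = Sum.inl r ∧ v = Sum.inr n ∧ H r n = 1

/-! ### The affine geometry and the extended incidence matrix -/

/-- The points of the affine geometry `AG(m, F)`. -/
abbrev Point (F : Type*) (m : ℕ) : Type _ := Fin m → F

/-- The lines (one-dimensional affine subspaces) of `AG(m, F)`. -/
abbrev Line (F : Type*) [Field F] (m : ℕ) : Type _ :=
  {L : AffineSubspace F (Point F m) // Module.finrank F L.direction = 1}

instance {F : Type*} [Field F] [Fintype F] (m : ℕ) : Finite (Line F m) :=
  Finite.of_injective (fun L : Line F m => (L.1 : Set (Point F m)))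
    fun _ _ h => Subtype.ext (SetLike.coe_injective h)

instance {F : Type*} [Field F] [Fintype F] (m : ℕ) : Fintype (Line F m) :=
  Fintype.ofFinite _

/-- The point-by-line incidence matrix of `AG(m, F)` over the field with two elements. -/
def agMatrix (F : Type*) [Field F] (m : ℕ) : Matrix (Point F m) (Line F m) (ZMod 2) :=
  Matrix.of fun p L => if p ∈ L.1 then 1 else 0

/-- The incidence matrix of the extended design: one new point `∞` (the row indexed by `Unit`) is
added together with the blocks `{∞, p}` (the columns indexed by the points `p`), that is,
the block matrix with rows `[I  H]` and `[1⋯1  0⋯0]`, where `H` is the incidence matrix of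
`AG(m, F)`. -/
def extMatrix (F : Type*) [Field F] [Fintype F] (m : ℕ) :
    Matrix (Point F m ⊕ Unit) (Point F m ⊕ Line F m) (ZMod 2) :=
  Matrix.fromBlocks 1 (agMatrix F m) (Matrix.of fun _ _ => 1) 0

/-! ### Entanglement-assisted quantum codes -/

/-- The Hilbert space with an orthonormal basis indexed by `X`. A register of qubits labelled
by `N` is `Hilb (N → ZMod 2)`, and `Hilb (X × Y)` is the tensor product of `Hilb X` and
`Hilb Y`. -/
abbrev Hilb (X : Type*) : Type _ := EuclideanSpace ℂ X

/-- The computational basis states of the qubits labelled by `N`. -/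
abbrev Bits (N : Type*) : Type _ := N → ZMod 2

/-- The state of `c` ebits: the tensor product of `c` copies of `(|00⟩ + |11⟩) / √2`, where the
first components are the halves of the sender and the second ones those of the receiver. -/
def ebits (c : ℕ) : Hilb (Bits (Fin c) × Bits (Fin c)) :=
  WithLp.toLp 2 fun p => if p.1 = p.2 then ((1 / Real.sqrt 2 : ℝ) : ℂ) ^ c else 0

/-- An `[[n, k; c]]` entanglement-assisted quantum code whose `n` physical qubits are labelled
by `N`: the encoder maps `k` logical qubits and the sender's halves of `c` ebits isometrically
into the physical qubits. (Such isometries are the unitary operations on the `n` qubits that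
are applied to the `k + c` qubits and to ancillas in the state `|0⟩`.) -/
structure Code (N : Type*) [Fintype N] (k c : ℕ) where
  enc : Hilb (Bits (Fin k) × Bits (Fin c)) →ₗᵢ[ℂ] Hilb (Bits N)

/-- The joint state of the physical qubits and the receiver's halves of the ebits after encoding
the logical state `ψ`, that is, `(enc ⊗ id) (ψ ⊗ ebits c)`. -/
def Code.encode {N : Type*} [Fintype N] {k c : ℕ} (Q : Code N k c) (ψ : Hilb (Bits (Fin k))) :
    Hilb (Bits N × Bits (Fin c)) :=
  WithLp.toLp 2 fun p =>
    Q.enc (WithLp.toLp 2 fun a => ψ a.1 * ebits c (a.2, p.2)) p.1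

/-- The Pauli error with bit errors (operators `X`) at the positions where `eX` is `1` and phase
errors (operators `Z`) at the positions where `eZ` is `1`. It acts on the physical qubits only:
the receiver's halves of the ebits are noiseless. On basis states it is
`|x⟩ ⊗ |j⟩ ↦ (-1) ^ (eZ · x) |x + eX⟩ ⊗ |j⟩`. -/
def pauli {N B : Type*} [Fintype N] (eX eZ : Bits N) (Ψ : Hilb (Bits N × B)) :
    Hilb (Bits N × B) :=
  WithLp.toLp 2 fun p =>
    (-1 : ℂ) ^ (eZ ⬝ᵥ (p.1 - eX)).val * Ψ (p.1 - eX, p.2)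

/-- The code `Q` is decoded by the binary linear code with parity-check matrix `H`: the receiver
has a projective measurement on the physical qubits and the halves of the ebits, with outcomes
`(sX, sZ)`, which for all bit errors `eX`, all phase errors `eZ` and every encoded state returns
the syndromes `H eX` and `H eZ` with certainty and leaves the corrupted state unchanged.
(The classical decoder for `H` then infers `eX` from `H eX` and `eZ` from `H eZ`, and the Pauli
error is undone.) -/
def Code.DecodedBy {N R : Type*} [Fintype N] [Fintype R] {k c : ℕ} (Q : Code N k c)
    (H : Matrix R N (ZMod 2)) : Prop :=
  ∃ P : (R → ZMod 2) × (R → ZMod 2) →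
      (Hilb (Bits N × Bits (Fin c)) →L[ℂ] Hilb (Bits N × Bits (Fin c))),
    (∀ s, IsStarProjection (P s)) ∧
    (∀ s t, s ≠ t → P s * P t = 0) ∧
    ∑ s, P s = 1 ∧
    ∀ (eX eZ : Bits N) (ψ : Hilb (Bits (Fin k))),
      P (H.mulVec eX, H.mulVec eZ) (pauli eX eZ (Q.encode ψ)) = pauli eX eZ (Q.encode ψ)

end EAQ

end

/-!
Write `q` for the order of `F` and `r = q ^ m + 1` for the number of rows of the extended matrix
`H'`. Its columns are the blocks of a design in which two points are on exactly one block. As `m` is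
even and `q` is odd, every point is on an odd number of blocks, hence `H' H'ᵀ` is the all-one matrix
(`extMatrix_mul_transpose`), and as `q` is odd the rows of `H'` are independent
(`extMatrix_transpose_mulVec_injective`). This gives both ranks, and the triangles of the design
give the girth.

*Minimum distance.* A codeword is a set `C` of lines together with the set `T` of the points that
are on an odd number of lines of `C`, where `#T` is even; its weight is `#C + #T`. In an affine
plane, `#C + #T ≥ 2 q` as soon as `#C ≥ 2` (`two_mul_le_card_add_card_oddPoints`). If `#C ≤ q`, this
is a count of the points that are on one line of `C` only. If `#C > q`, let `e` be the number of
lines of `C` in a given direction. Counting incidences modulo `2` shows that, when `#C - e` is odd,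
each of the `q - e` other lines of that direction meets `T`; and each of the `e` lines in `C`
contains at least `q - (#C - e)` points of `T`. So `#T ≥ q - e ≥ 2 q - #C` if `e ≤ #C - q`, and `#T
≥ q` otherwise. When `#C - e` is even for all directions, `C` consists of the lines that meet `T` in
an odd number of points, in particular of all tangents of `T`, so that `#C ≥ #T (q + 2 - #T)`. In
dimension `m` either the lines of `C` are pairwise disjoint and `T` is their union, or two of them
meet and span a plane, and restricting to this plane does not increase `#C + #T`, since a line
outside the plane meets it in at most one point (`card_add_card_oddPoints_le`). The case `#C = 1`
does not occur, as then `#T = q` would be odd.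

*Ebits.* Corrupted states with different syndromes are fixed by orthogonal projections, hence
orthogonal. Without ebits this yields `2 ^ (2 r)` pairwise orthogonal subspaces of dimension `2 ^ k`
in a space of dimension `2 ^ n`, which is impossible for `k = n - 2 r + 1`
(`Code.DecodedBy.add_two_mul_card_le`). With one ebit, the receiver's qubit adds an all-one column
to `H'`, and the rows of `[H' 1]` are orthogonal to each other and to themselves; so they define a
CSS code on `n + 1` qubits with `n + 1 - 2 r` logical qubits. Its basis states are uniform
superpositions over cosets of the row space, and each of them is half `0` and half `1` on the
receiver's qubit, so they arise from an encoder that acts on the sender's half of an ebit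
(`exists_code_one_ebit`). Errors with different syndromes take stabilized states to orthogonal ones
(`IsStabilized.inner_pauli_eq_zero`), and pairwise orthogonal subspaces are distinguished by a
projective measurement (`exists_measurement`).
-/

namespace EAQ

open Finset

/-! ### Lines and odd points in an affine plane -/

section Net

variable {P D K : Type*}

/-- The number of lines of `C` through the point `p`. An affine plane is given here by its points
`P`, its directions `D` and coordinates `φ δ : P → K`: the line `(δ, b)` consists of the points at
which `φ δ` takes the value `b`. The property used below is that `(φ δ, φ δ')` is bijective for
`δ ≠ δ'`, that is, two lines of different directions meet in exactly one point. -/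
noncomputable def cover (φ : D → P → K) (C : Finset (D × K)) (p : P) : ℕ :=
  #{l ∈ C | φ l.1 p = l.2}

/-- The points on an odd number of lines of `C`. -/
noncomputable def oddPoints [Fintype P] (φ : D → P → K) (C : Finset (D × K)) : Finset P :=
  {p | Odd (cover φ C p)}

variable {φ : D → P → K} {q : ℕ}

theorem card_line_inter_line [Fintype P]
    (hφ : ∀ δ δ', δ ≠ δ' → Function.Bijective fun p => (φ δ p, φ δ' p))
    {δ δ' : D} (h : δ ≠ δ') (b b' : K) : #{p | φ δ p = b ∧ φ δ' p = b'} = 1 := by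
  obtain ⟨p, hp⟩ := (hφ δ δ' h).2 (b, b')
  simp only [Prod.mk.injEq] at hp
  rw [card_eq_one]
  refine ⟨p, ?_⟩
  ext x
  simp only [mem_filter, mem_univ, true_and, mem_singleton]
  refine ⟨fun hx => (hφ δ δ' h).1 ?_, ?_⟩
  · simp [hx.1, hx.2, hp.1, hp.2]
  · rintro rfl
    exact hp

theorem card_line [Fintype P] [Fintype K]
    (hφ : ∀ δ δ', δ ≠ δ' → Function.Bijective fun p => (φ δ p, φ δ' p))
    (hK : Fintype.card K = q) [Nontrivial D] (δ : D) (b : K) : #{p | φ δ p = b} = q := by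
  obtain ⟨δ', h⟩ := exists_ne δ
  rw [card_eq_sum_card_fiberwise (f := φ δ') (t := univ) (by simp)]
  simp only [filter_filter, card_line_inter_line hφ h.symm]
  simp [hK]

/-- Double counting of the incidences between the points of a line and the lines of `C`. -/
theorem sum_cover_line [Fintype P] [Fintype K]
    (hφ : ∀ δ δ', δ ≠ δ' → Function.Bijective fun p => (φ δ p, φ δ' p))
    (hK : Fintype.card K = q) [Nontrivial D] (C : Finset (D × K)) (δ : D) (b : K) :
    ∑ p with φ δ p = b, cover φ C p =
      #{l ∈ C | l.1 ≠ δ} + if (δ, b) ∈ C then q else 0 := by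
  have h1 : ∑ p with φ δ p = b, cover φ C p = ∑ l ∈ C, #{p | φ δ p = b ∧ φ l.1 p = l.2} := by
    have := sum_card_bipartiteAbove_eq_sum_card_bipartiteBelow (s := {p | φ δ p = b}) (t := C)
      (fun p (l : D × K) => φ l.1 p = l.2)
    simp only [bipartiteBelow, bipartiteAbove, filter_filter] at this
    unfold cover
    convert this
  have h2 : ∀ l : D × K, #{p | φ δ p = b ∧ φ l.1 p = l.2} =
      (if l.1 ≠ δ then 1 else 0) + if l = (δ, b) then q else 0 := by
    rintro ⟨δ', b'⟩
    by_cases h : δ' = δ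
    · subst h
      by_cases hb : b' = b
      · subst hb
        simp [card_line hφ hK]
      · have : ∀ p, ¬ (φ δ' p = b ∧ φ δ' p = b') := fun p hp => hb (hp.2.symm.trans hp.1)
        simp [this, hb]
    · simp [h, card_line_inter_line hφ (Ne.symm h)]
  rw [h1, sum_congr rfl fun l _ => h2 l, sum_add_distrib, card_filter]
  simp

theorem odd_card_oddPoints_line [Fintype P] [Fintype K]
    (hφ : ∀ δ δ', δ ≠ δ' → Function.Bijective fun p => (φ δ p, φ δ' p))
    (hK : Fintype.card K = q) [Nontrivial D] (C : Finset (D × K)) (δ : D) (b : K) :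
    Odd #{p ∈ oddPoints φ C | φ δ p = b} ↔
      Odd (#{l ∈ C | l.1 ≠ δ} + if (δ, b) ∈ C then q else 0) := by
  rw [← sum_cover_line hφ hK, odd_sum_iff_odd_card_odd, oddPoints, filter_filter, filter_filter]
  simp only [and_comm]

theorem cover_pos {C : Finset (D × K)} {δ : D} {b : K} (h : (δ, b) ∈ C) {p : P} (hp : φ δ p = b) :
    0 < cover φ C p :=
  card_pos.2 ⟨(δ, b), by simp [h, hp]⟩

/-- A point of a line of `C` that is not an odd point lies on a second line of `C`. -/
theorem le_card_oddPoints_line [Fintype P] [Fintype K]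
    (hφ : ∀ δ δ', δ ≠ δ' → Function.Bijective fun p => (φ δ p, φ δ' p))
    (hK : Fintype.card K = q) [Nontrivial D] {C : Finset (D × K)} {δ : D} {b : K}
    (h : (δ, b) ∈ C) :
    q ≤ #{p ∈ oddPoints φ C | φ δ p = b} + #{l ∈ C | l.1 ≠ δ} := by
  have h1 := sum_cover_line hφ hK C δ b
  rw [if_pos h] at h1
  have h2 : ∑ p with φ δ p = b, (1 + if Odd (cover φ C p) then 0 else 1) ≤
      ∑ p with φ δ p = b, cover φ C p := by
    refine sum_le_sum fun p hp => ?_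
    have := cover_pos h (mem_filter.1 hp).2
    split_ifs with ho
    · omega
    · obtain ⟨k, hk⟩ := Nat.not_odd_iff_even.1 ho
      omega
  rw [sum_add_distrib, sum_const, smul_eq_mul, mul_one, card_line hφ hK, h1] at h2
  have h3 : ∑ p with φ δ p = b, ((if Odd (cover φ C p) then 0 else 1) +
      if Odd (cover φ C p) then 1 else 0) = q := by
    rw [← card_line hφ hK δ b, card_eq_sum_ones]
    exact sum_congr rfl fun p _ => by split_ifs <;> rfl
  have h4 : #{p ∈ oddPoints φ C | φ δ p = b} =
      ∑ p with φ δ p = b, if Odd (cover φ C p) then 1 else 0 := by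
    rw [← card_filter, oddPoints, filter_filter, filter_filter]
    simp only [and_comm]
  rw [sum_add_distrib] at h3
  omega

/-- Every line of `C` has many points that lie on no other line of `C` when `C` is small. -/
theorem mul_le_card_oddPoints [Fintype P] [Fintype K]
    (hφ : ∀ δ δ', δ ≠ δ' → Function.Bijective fun p => (φ δ p, φ δ' p))
    (hK : Fintype.card K = q) [Nontrivial D] (C : Finset (D × K)) :
    #C * (q + 1 - #C) ≤ #(oddPoints φ C) := by
  have key : ∀ l ∈ C, q + 1 - #C ≤ #{p | cover φ C p = 1 ∧ φ l.1 p = l.2} := by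
    rintro ⟨δ, b⟩ h
    have h1 := sum_cover_line hφ hK C δ b
    rw [if_pos h] at h1
    have h2 : ∑ p with φ δ p = b, (2 - if cover φ C p = 1 then 1 else 0) ≤
        ∑ p with φ δ p = b, cover φ C p := by
      refine sum_le_sum fun p hp => ?_
      have := cover_pos h (mem_filter.1 hp).2
      split_ifs <;> omega
    have h3 : ∑ p with φ δ p = b, ((2 - if cover φ C p = 1 then 1 else 0) +
        if cover φ C p = 1 then 1 else 0) = q * 2 := by
      rw [← card_line hφ hK δ b, ← smul_eq_mul, ← sum_const]
      exact sum_congr rfl fun p _ => by split_ifs <;> rfl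
    rw [sum_add_distrib, ← card_filter, filter_filter] at h3
    have h4 : #{l ∈ C | l.1 ≠ δ} < #C :=
      card_lt_card ⟨filter_subset _ _, fun hs => by simpa using hs h⟩
    simp only [and_comm] at h3 ⊢
    omega
  have h1 : ∑ l ∈ C, #{p | cover φ C p = 1 ∧ φ l.1 p = l.2} = #{p | cover φ C p = 1} := by
    have := sum_card_bipartiteAbove_eq_sum_card_bipartiteBelow (s := {p | cover φ C p = 1}) (t := C)
      (fun p (l : D × K) => φ l.1 p = l.2)
    simp only [bipartiteBelow, bipartiteAbove, filter_filter] at this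
    rw [← this, card_eq_sum_ones]
    exact sum_congr rfl fun p hp => (mem_filter.1 hp).2
  calc #C * (q + 1 - #C) = ∑ l ∈ C, (q + 1 - #C) := by simp
    _ ≤ #{p | cover φ C p = 1} := h1 ▸ sum_le_sum key
    _ ≤ #(oddPoints φ C) := card_le_card fun p hp => by
      simp only [oddPoints, mem_filter, mem_univ, true_and] at hp ⊢
      simp [hp]

/-- A set `T` of points of the net has at least `q + 2 - #T` tangent directions at each of its
points. -/
theorem le_card_tangents [Fintype D]
    (hφ : ∀ δ δ', δ ≠ δ' → Function.Bijective fun p => (φ δ p, φ δ' p))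
    (hD : Fintype.card D = q + 1) (T : Finset P) {p : P} (hp : p ∈ T) :
    q + 2 - #T ≤ #{δ : D | ∀ x ∈ T, φ δ x = φ δ p → x = p} := by
  have h1 := card_filter_add_card_filter_not (s := (univ : Finset D))
    (fun δ => ∀ x ∈ T, φ δ x = φ δ p → x = p)
  rw [card_univ, hD] at h1
  have h2 : #{δ : D | ¬ ∀ x ∈ T, φ δ x = φ δ p → x = p} ≤ #(T.erase p) := by
    have : ∀ δ : D, ∃ x, (¬ ∀ x ∈ T, φ δ x = φ δ p → x = p) →
        x ∈ T ∧ φ δ x = φ δ p ∧ x ≠ p := by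
      intro δ
      by_cases h : ∀ x ∈ T, φ δ x = φ δ p → x = p
      · exact ⟨p, fun h' => absurd h h'⟩
      · push Not at h
        obtain ⟨x, hx⟩ := h
        exact ⟨x, fun _ => hx⟩
    choose f hf using this
    refine card_le_card_of_injOn f (fun δ hδ => ?_) fun δ hδ δ' hδ' he => ?_
    · have := hf δ (mem_filter.1 hδ).2
      simp [this]
    · have a := hf δ (mem_filter.1 hδ).2
      have a' := hf δ' (mem_filter.1 hδ').2
      rw [← he] at a'
      by_contra hne
      exact a.2.2 ((hφ δ δ' hne).1 (by simp [a.2.1, a'.2.1]))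
  rw [card_erase_of_mem hp] at h2
  have := card_pos.2 ⟨p, hp⟩
  omega

/-- In an affine plane of odd order `q`, any two or more lines together with the points that they
cover an odd number of times number at least `2 q`. -/
theorem two_mul_le_card_add_card_oddPoints [Fintype P] [Fintype D] [Fintype K]
    (hφ : ∀ δ δ', δ ≠ δ' → Function.Bijective fun p => (φ δ p, φ δ' p))
    (hK : Fintype.card K = q) (hD : Fintype.card D = q + 1) (hq : Odd q)
    (C : Finset (D × K)) (hC : 2 ≤ #C) : 2 * q ≤ #C + #(oddPoints φ C) := by
  have hq0 : 0 < q := hq.pos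
  have : Nontrivial D := Fintype.one_lt_card_iff_nontrivial.1 (by omega)
  by_contra! hlt
  rcases le_or_gt #C q with hs | hs
  · have h1 := mul_le_card_oddPoints hφ hK C
    obtain ⟨a, ha⟩ := Nat.exists_eq_add_of_le hC
    obtain ⟨c, hc⟩ := Nat.exists_eq_add_of_le hs
    rw [show q + 1 - #C = c + 1 by omega] at h1
    rw [ha] at h1 hlt hc
    subst hc
    nlinarith [Nat.zero_le (a * c)]
  by_cases hpar : ∃ δ, Odd #{l ∈ C | l.1 ≠ δ}
  · obtain ⟨δ, hδ⟩ := hpar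
    -- a line of direction `δ` outside `C` has an odd number of odd points
    have hout : ∀ b, (δ, b) ∉ C → 1 ≤ #{p ∈ oddPoints φ C | φ δ p = b} := fun b hb =>
      ((odd_card_oddPoints_line hφ hK C δ b).2 (by simpa [hb] using hδ)).pos
    have hT : #(oddPoints φ C) = ∑ b : K, #{p ∈ oddPoints φ C | φ δ p = b} :=
      card_eq_sum_card_fiberwise (by simp)
    have hsum := card_filter_add_card_filter_not (s := C) (fun l => l.1 ≠ δ)
    rcases le_or_gt q #{l ∈ C | l.1 ≠ δ} with he | he
    · have h1 : ∑ b : K, (1 - if (δ, b) ∈ C then 1 else 0) ≤ #(oddPoints φ C) := by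
        rw [hT]
        refine sum_le_sum fun b _ => ?_
        split_ifs with hb
        · simp
        · simpa using hout b hb
      have h2 : ∑ b : K, ((1 - if (δ, b) ∈ C then 1 else 0) + if (δ, b) ∈ C then 1 else 0) = q := by
        rw [← hK, ← card_univ, card_eq_sum_ones]
        exact sum_congr rfl fun b _ => by split_ifs <;> rfl
      rw [sum_add_distrib, ← card_filter] at h2
      have h3 : #{b : K | (δ, b) ∈ C} ≤ #{l ∈ C | ¬ l.1 ≠ δ} :=
        card_le_card_of_injOn (fun b => (δ, b)) (fun b hb => by simpa using hb)
          fun b _ b' _ h => (Prod.mk.inj h).2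
      omega
    · have h1 : ∑ b : K, 1 ≤ #(oddPoints φ C) := by
        rw [hT]
        refine sum_le_sum fun b _ => ?_
        by_cases hb : (δ, b) ∈ C
        · have := le_card_oddPoints_line hφ hK hb
          omega
        · exact hout b hb
      simp only [sum_const, smul_eq_mul, mul_one, card_univ, hK] at h1
      omega
  · push Not at hpar
    -- the lines of `C` are exactly those with an odd number of odd points
    have hmem : ∀ δ b, (δ, b) ∈ C ↔ Odd #{p ∈ oddPoints φ C | φ δ p = b} := by
      intro δ b
      rw [odd_card_oddPoints_line hφ hK]
      have := Nat.not_odd_iff_even.1 (by simpa using hpar δ)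
      split_ifs with h
      · simp [h, this.add_odd hq]
      · simpa [h] using this
    set T := oddPoints φ C with hTdef
    have htan : ∀ p ∈ T, ∀ δ, (∀ x ∈ T, φ δ x = φ δ p → x = p) → (δ, φ δ p) ∈ C := by
      intro p hp δ h
      rw [hmem, show ({x ∈ T | φ δ x = φ δ p} : Finset P) = {p} by
        ext x
        simp only [mem_filter, mem_singleton]
        exact ⟨fun hx => h x hx.1 hx.2, by rintro rfl; exact ⟨hp, rfl⟩⟩]
      simp
    have hTne : T.Nonempty := by
      obtain ⟨⟨δ, b⟩, hl⟩ := card_pos.1 (by omega : 0 < #C)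
      obtain ⟨p, hp⟩ := card_pos.1 ((hmem δ b).1 hl).pos
      exact ⟨p, (mem_filter.1 hp).1⟩
    -- all `q + 1` lines through a single odd point would be in `C`, an even number
    have hT1 : #T ≠ 1 := by
      intro h
      obtain ⟨p, hp⟩ := card_eq_one.1 h
      have hpT : p ∈ T := by simp [hp]
      have hodd : Odd (cover φ C p) := (mem_filter.1 hpT).2
      have : cover φ C p = q + 1 := by
        rw [← hD, ← card_univ, cover]
        refine (card_bij (fun δ _ => (δ, φ δ p)) (fun δ _ => ?_) (fun δ _ δ' _ h => ?_) ?_).symm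
        · simp only [mem_filter, and_true]
          exact htan p hpT δ fun x hx _ => by simpa [hp] using hx
        · exact (Prod.mk.inj h).1
        · rintro ⟨δ, b⟩ hl
          exact ⟨δ, mem_univ _, by rw [(mem_filter.1 hl).2]⟩
      rw [this] at hodd
      exact Nat.not_odd_iff_even.2 (hq.add_odd odd_one) hodd
    have hs2 : #T * (q + 2 - #T) ≤ #C := by
      calc #T * (q + 2 - #T) = ∑ p ∈ T, (q + 2 - #T) := by simp
        _ ≤ ∑ p ∈ T, #{δ : D | ∀ x ∈ T, φ δ x = φ δ p → x = p} :=
          sum_le_sum fun p hp => (le_card_tangents hφ hD T hp).trans_eq (by congr)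
        _ = #(T.sigma fun p => {δ : D | ∀ x ∈ T, φ δ x = φ δ p → x = p}) := (card_sigma _ _).symm
        _ ≤ #C := by
          refine card_le_card_of_injOn (fun x => (x.2, φ x.2 x.1)) ?_ ?_
          · rintro ⟨p, δ⟩ h
            simp only [coe_sigma, Set.mem_sigma_iff, mem_coe, mem_filter, mem_univ, true_and] at h
            exact htan p h.1 δ h.2
          · rintro ⟨p, δ⟩ h ⟨p', δ'⟩ h' he
            simp only [coe_sigma, Set.mem_sigma_iff, mem_coe, mem_filter, mem_univ, true_and]
              at h h'
            simp only [Prod.mk.injEq] at he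
            obtain ⟨rfl, he⟩ := he
            rw [h'.2 p h.1 he]
    have hpos := hTne.card_pos
    obtain ⟨a, ha⟩ := Nat.exists_eq_add_of_le (by omega : 2 ≤ #T)
    obtain ⟨c, hc⟩ := Nat.exists_eq_add_of_le (by omega : #T ≤ q)
    rw [show q + 2 - #T = c + 2 by omega] at hs2
    rw [ha] at hs2 hc hlt
    subst hc
    nlinarith [Nat.zero_le (a * c)]

end Net

/-! ### Lines of the affine geometry -/

section Lines

variable {F : Type*} [Field F] {m : ℕ}

/-- The line through `a` with direction vector `v`. -/
def lineThrough (a v : Point F m) (hv : v ≠ 0) : Line F m :=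
  ⟨AffineSubspace.mk' a (Submodule.span F {v}), by
    rw [AffineSubspace.direction_mk', finrank_span_singleton hv]⟩

theorem mem_lineThrough {a v p : Point F m} {hv : v ≠ 0} :
    p ∈ (lineThrough a v hv).1 ↔ ∃ t : F, p = a + t • v := by
  rw [lineThrough, AffineSubspace.mem_mk', vsub_eq_sub, Submodule.mem_span_singleton]
  exact exists_congr fun t => by rw [eq_sub_iff_add_eq', eq_comm]

theorem Line.eq_of_mem_of_mem {L L' : Line F m} {p p' : Point F m} (h : p ≠ p')
    (hp : p ∈ L.1) (hp' : p' ∈ L.1) (hq : p ∈ L'.1) (hq' : p' ∈ L'.1) : L = L' := by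
  have key : ∀ M : Line F m, p ∈ M.1 → p' ∈ M.1 →
      Submodule.span F {p' -ᵥ p} = M.1.direction := fun M h1 h2 => by
    refine Submodule.eq_of_le_of_finrank_eq ?_ ?_
    · rw [Submodule.span_singleton_le_iff_mem]
      exact AffineSubspace.vsub_mem_direction h2 h1
    · rw [M.2, finrank_span_singleton (vsub_ne_zero.2 h.symm)]
  exact Subtype.ext <| AffineSubspace.ext_of_direction_eq
    ((key L hp hp').symm.trans (key L' hq hq')) ⟨p, hp, hq⟩

theorem Line.exists_eq_lineThrough (L : Line F m) {a : Point F m} (ha : a ∈ L.1) :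
    ∃ v, ∃ hv : v ≠ 0, L = lineThrough a v hv := by
  obtain ⟨v, hv, hspan⟩ := finrank_eq_one_iff'.1 L.2
  have hv0 : (v : Point F m) ≠ 0 := fun h => hv (Subtype.ext h)
  refine ⟨v, hv0, Line.eq_of_mem_of_mem (p := a) (p' := (v : Point F m) + a) ?_ ha ?_ ?_ ?_⟩
  · simpa using hv0
  · exact AffineSubspace.vadd_mem_of_mem_direction v.2 ha
  · exact mem_lineThrough.2 ⟨0, by simp⟩
  · exact mem_lineThrough.2 ⟨1, by simp [add_comm]⟩

theorem Line.nonempty (L : Line F m) : ∃ a, a ∈ L.1 := by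
  have h : (L.1 : Set (Point F m)).Nonempty := by
    refine (AffineSubspace.nonempty_iff_ne_bot _).2 fun h => ?_
    have := L.2
    rw [h, AffineSubspace.direction_bot, finrank_bot] at this
    omega
  exact h

theorem exists_line {p p' : Point F m} (h : p ≠ p') : ∃ L : Line F m, p ∈ L.1 ∧ p' ∈ L.1 :=
  ⟨lineThrough p (p' - p) (sub_ne_zero.2 h.symm), mem_lineThrough.2 ⟨0, by simp⟩,
    mem_lineThrough.2 ⟨1, by simp⟩⟩

variable [Fintype F]

theorem card_points_line (L : Line F m) :
    #{p : Point F m | p ∈ L.1} = Fintype.card F := by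
  obtain ⟨a, ha⟩ := L.nonempty
  obtain ⟨v, hv, rfl⟩ := L.exists_eq_lineThrough ha
  rw [← card_univ, ← card_image_of_injective univ (f := fun t : F => a + t • v)]
  · congr 1
    ext p
    simp [mem_lineThrough, eq_comm]
  · intro t t' h
    exact smul_left_injective F hv (by simpa using h)

theorem card_lines_through_two {p p' : Point F m} (h : p ≠ p') :
    #{L : Line F m | p ∈ L.1 ∧ p' ∈ L.1} = 1 := by
  obtain ⟨L, hL, hL'⟩ := exists_line h
  rw [card_eq_one]
  refine ⟨L, ?_⟩
  ext M
  simp only [mem_filter, mem_univ, true_and, mem_singleton]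
  refine ⟨fun hM => Line.eq_of_mem_of_mem h hM.1 hM.2 hL hL', ?_⟩
  rintro rfl
  exact ⟨hL, hL'⟩

/-- The lines through `p` partition the other points. -/
theorem card_lines_through_mul (p : Point F m) :
    #{L : Line F m | p ∈ L.1} * (Fintype.card F - 1) = Fintype.card F ^ m - 1 := by
  have h := sum_card_bipartiteAbove_eq_sum_card_bipartiteBelow
    (s := univ.erase p) (t := {L : Line F m | p ∈ L.1}) (fun x (L : Line F m) => x ∈ L.1)
  simp only [bipartiteAbove, bipartiteBelow, filter_filter] at h
  have hL : ∀ L ∈ ({L : Line F m | p ∈ L.1} : Finset (Line F m)),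
      #{x ∈ univ.erase p | x ∈ L.1} = Fintype.card F - 1 := fun L hL => by
    rw [filter_erase, card_erase_of_mem (by simpa using hL), card_points_line]
  rw [sum_congr rfl fun x hx => card_lines_through_two (ne_of_mem_erase hx).symm,
    sum_congr rfl hL] at h
  simp only [sum_const, smul_eq_mul, mul_one] at h
  rw [← h, card_erase_of_mem (mem_univ _)]
  simp

theorem card_line_mul :
    Fintype.card (Line F m) * Fintype.card F * (Fintype.card F - 1) =
      Fintype.card F ^ m * (Fintype.card F ^ m - 1) := by
  have h := sum_card_bipartiteAbove_eq_sum_card_bipartiteBelow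
    (s := (univ : Finset (Point F m))) (t := univ) (fun x (L : Line F m) => x ∈ L.1)
  simp only [bipartiteAbove, bipartiteBelow, card_points_line, sum_const, smul_eq_mul,
    card_univ] at h
  rw [← h, sum_mul, sum_congr rfl fun p _ => card_lines_through_mul p]
  simp

/-- The number of lines through a point is the sum of the `m` odd numbers `q ^ i`, `i < m`. -/
theorem even_card_lines_through (hm : Even m) (hF : Odd (Fintype.card F)) (p : Point F m) :
    Even #{L : Line F m | p ∈ L.1} := by
  have h := card_lines_through_mul p
  have h2 : #{L : Line F m | p ∈ L.1} = ∑ i ∈ range m, Fintype.card F ^ i := by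
    have hq : 1 < Fintype.card F := Fintype.one_lt_card
    refine Nat.eq_of_mul_eq_mul_right (by omega : 0 < Fintype.card F - 1) ?_
    rw [h, Nat.geomSum_eq hq, Nat.div_mul_cancel]
    simpa using Nat.sub_dvd_pow_sub_pow (Fintype.card F) 1 m
  rw [h2, even_sum_iff_even_card_odd]
  simpa [hF.pow] using hm

end Lines

/-! ### Planes of the affine geometry -/

section Plane

variable {F : Type*} [Field F] {m : ℕ}

/-- The coordinates of the affine plane `F × F` whose level sets are its lines: for a slope `s`
the lines `y = s x + b`, and for `none` the vertical lines `x = b`. -/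
def slopeCoord : Option F → F × F → F
  | some s, p => p.2 - s * p.1
  | none, p => p.1

theorem slopeCoord_bijective {δ δ' : Option F} (h : δ ≠ δ') :
    Function.Bijective fun p => (slopeCoord δ p, slopeCoord δ' p) := by
  refine Function.bijective_iff_has_inverse.2 ?_
  rcases δ with _ | s <;> rcases δ' with _ | s'
  · exact absurd rfl h
  · refine ⟨fun c => (c.1, c.2 + s' * c.1), fun p => ?_, fun c => ?_⟩ <;> simp [slopeCoord]
  · refine ⟨fun c => (c.2, c.1 + s * c.2), fun p => ?_, fun c => ?_⟩ <;> simp [slopeCoord]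
  · have hs : s' - s ≠ 0 := sub_ne_zero.2 fun h' => h (by rw [h'])
    refine ⟨fun c => ((c.1 - c.2) / (s' - s), c.1 + s * ((c.1 - c.2) / (s' - s))),
      fun p => ?_, fun c => ?_⟩
    · ext <;> simp only [slopeCoord] <;> field_simp <;> ring
    · ext <;> simp only [slopeCoord] <;> field_simp <;> ring

theorem exists_slopeCoord_eq (p p' : F × F) : ∃ δ, slopeCoord δ p = slopeCoord δ p' := by
  by_cases h : p.1 = p'.1
  · exact ⟨none, h⟩
  · have : p.1 - p'.1 ≠ 0 := sub_ne_zero.2 h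
    refine ⟨some ((p.2 - p'.2) / (p.1 - p'.1)), ?_⟩
    simp only [slopeCoord]
    field_simp
    ring

/-- The parametrization of the plane through `o` spanned by `u` and `v`. -/
def planePoint (o u v : Point F m) (p : F × F) : Point F m := o + p.1 • u + p.2 • v

variable {o u v : Point F m}

/-- The line of the plane through `o` spanned by `u` and `v` that has coordinates `l`. -/
def planeLine (o : Point F m) (huv : LinearIndependent F ![u, v]) : Option F × F → Line F m
  | (some s, b) => lineThrough (o + b • v) (u + s • v) fun h => by
      simpa using (LinearIndependent.pair_iff.1 huv 1 s (by simpa using h)).1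
  | (none, b) => lineThrough (o + b • u) v (by simpa using huv.ne_zero 1)

theorem planePoint_injective (o : Point F m) (huv : LinearIndependent F ![u, v]) :
    Function.Injective (planePoint o u v) := by
  intro p p' h
  have := LinearIndependent.pair_iff.1 huv (p.1 - p'.1) (p.2 - p'.2) (by
    simp only [planePoint] at h
    rw [← sub_eq_zero] at h
    rw [← h]
    module)
  exact Prod.ext (sub_eq_zero.1 this.1) (sub_eq_zero.1 this.2)

theorem mem_planeLine {huv : LinearIndependent F ![u, v]} {l : Option F × F} {x : Point F m} :
    x ∈ (planeLine o huv l).1 ↔ ∃ p, slopeCoord l.1 p = l.2 ∧ planePoint o u v p = x := by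
  rcases l with ⟨_ | s, b⟩
  · simp only [planeLine, mem_lineThrough, slopeCoord, planePoint]
    constructor
    · rintro ⟨t, rfl⟩
      exact ⟨(b, t), rfl, rfl⟩
    · rintro ⟨p, rfl, rfl⟩
      exact ⟨p.2, rfl⟩
  · simp only [planeLine, mem_lineThrough, slopeCoord, planePoint]
    constructor
    · rintro ⟨t, rfl⟩
      refine ⟨(t, b + s * t), by simp, ?_⟩
      simp only
      module
    · rintro ⟨p, rfl, rfl⟩
      refine ⟨p.1, ?_⟩
      module

theorem planePoint_mem_planeLine {huv : LinearIndependent F ![u, v]} {l : Option F × F}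
    {p : F × F} : planePoint o u v p ∈ (planeLine o huv l).1 ↔ slopeCoord l.1 p = l.2 := by
  rw [mem_planeLine]
  refine ⟨?_, fun h => ⟨p, h, rfl⟩⟩
  rintro ⟨p', h, h'⟩
  rwa [← planePoint_injective o huv h']

theorem planeLine_injective (o : Point F m) (huv : LinearIndependent F ![u, v]) :
    Function.Injective (planeLine o huv) := by
  rintro ⟨δ, b⟩ ⟨δ', b'⟩ h
  have key : ∀ p, slopeCoord δ p = b ↔ slopeCoord δ' p = b' := fun p => by
    simpa [planePoint_mem_planeLine] using
      iff_of_eq (congrArg (fun L : Line F m => planePoint o u v p ∈ L.1) h)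
  have hδ : δ = δ' := by
    by_contra hne
    obtain ⟨p, hp⟩ := (slopeCoord_bijective hne).2 (b, b' + 1)
    simp only [Prod.mk.injEq] at hp
    have := (key p).1 hp.1
    rw [hp.2] at this
    simp at this
  subst hδ
  obtain ⟨δ', hδ'⟩ := exists_ne δ
  obtain ⟨p, hp⟩ := (slopeCoord_bijective hδ'.symm).2 (b, 0)
  simp only [Prod.mk.injEq] at hp
  rw [← hp.1, (key p).1 hp.1]

theorem mem_range_planeLine {huv : LinearIndependent F ![u, v]} {L : Line F m} {p p' : F × F}
    (h : p ≠ p') (hp : planePoint o u v p ∈ L.1) (hp' : planePoint o u v p' ∈ L.1) :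
    L ∈ Set.range (planeLine o huv) := by
  obtain ⟨δ, hδ⟩ := exists_slopeCoord_eq p p'
  exact ⟨(δ, slopeCoord δ p), Line.eq_of_mem_of_mem ((planePoint_injective o huv).ne h)
    (planePoint_mem_planeLine.2 rfl) (planePoint_mem_planeLine.2 hδ.symm) hp hp'⟩

variable [Fintype F]

/-- The points on an odd number of the lines of `C`. -/
noncomputable def oddSet (C : Finset (Line F m)) : Finset (Point F m) :=
  {p | Odd #{L ∈ C | p ∈ L.1}}

/-- Restricting a set of lines to a plane does not increase the number of lines plus odd points:
each line outside the plane meets it in at most one point. -/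
theorem card_add_card_oddPoints_le (o : Point F m) (huv : LinearIndependent F ![u, v])
    (C : Finset (Line F m)) :
    #{l | planeLine o huv l ∈ C} + #(oddPoints slopeCoord {l | planeLine o huv l ∈ C}) ≤
      #C + #(oddSet C) := by
  set C₀ : Finset (Option F × F) := {l | planeLine o huv l ∈ C} with hC₀
  set C₁ : Finset (Line F m) := {L ∈ C | L ∉ Set.range (planeLine o huv)} with hC₁
  have himg : C₀.image (planeLine o huv) = {L ∈ C | L ∈ Set.range (planeLine o huv)} := by
    ext L
    simp only [hC₀, mem_image, mem_filter, mem_univ, true_and, Set.mem_range]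
    constructor
    · rintro ⟨l, h, rfl⟩
      exact ⟨h, l, rfl⟩
    · rintro ⟨h, l, rfl⟩
      exact ⟨l, h, rfl⟩
  have hcard : #C₀ + #C₁ = #C := by
    rw [← card_image_of_injective C₀ (planeLine_injective o huv), himg]
    exact card_filter_add_card_filter_not _
  have hcover : ∀ p, cover slopeCoord C₀ p + #{L ∈ C₁ | planePoint o u v p ∈ L.1} =
      #{L ∈ C | planePoint o u v p ∈ L.1} := by
    intro p
    rw [← card_filter_add_card_filter_not (s := {L ∈ C | planePoint o u v p ∈ L.1})
      (fun L => L ∈ Set.range (planeLine o huv)), cover,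
      ← card_image_of_injective _ (planeLine_injective o huv)]
    congr 2
    · ext L
      simp only [hC₀, mem_image, mem_filter, mem_univ, true_and, Set.mem_range]
      constructor
      · rintro ⟨l, ⟨h, h'⟩, rfl⟩
        exact ⟨⟨h, planePoint_mem_planeLine.2 h'⟩, l, rfl⟩
      · rintro ⟨⟨h, h'⟩, l, rfl⟩
        exact ⟨l, ⟨h, planePoint_mem_planeLine.1 h'⟩, rfl⟩
    · ext L
      simp only [hC₁, mem_filter]
      tauto
  have hsub : oddPoints slopeCoord C₀ ⊆ univ.filter (fun p => planePoint o u v p ∈ oddSet C) ∪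
      univ.filter (fun p => ∃ L ∈ C₁, planePoint o u v p ∈ L.1) := by
    intro p hp
    simp only [oddPoints, oddSet, mem_filter, mem_univ, true_and, mem_union] at hp ⊢
    by_contra! h
    have h0 : #{L ∈ C₁ | planePoint o u v p ∈ L.1} = 0 := by
      rw [card_eq_zero, filter_eq_empty_iff]
      exact fun L hL => h.2 L hL
    rw [← hcover, h0, add_zero] at h
    exact h.1 hp
  have h1 : #(univ.filter fun p => planePoint o u v p ∈ oddSet C) ≤ #(oddSet C) :=
    card_le_card_of_injOn (planePoint o u v) (fun p hp => (mem_filter.1 hp).2)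
      (planePoint_injective o huv).injOn
  have h2 : #(univ.filter fun p => ∃ L ∈ C₁, planePoint o u v p ∈ L.1) ≤ #C₁ := by
    have : ∀ p, ∃ L, (∃ L ∈ C₁, planePoint o u v p ∈ L.1) → L ∈ C₁ ∧ planePoint o u v p ∈ L.1 := by
      intro p
      by_cases h : ∃ L ∈ C₁, planePoint o u v p ∈ L.1
      · obtain ⟨L, hL⟩ := h
        exact ⟨L, fun _ => hL⟩
      · exact ⟨planeLine o huv (none, 0), fun h' => absurd h' h⟩
    choose f hf using this
    refine card_le_card_of_injOn f (fun p hp => (hf p (mem_filter.1 hp).2).1)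
      fun p hp p' hp' he => ?_
    have a := hf p (mem_filter.1 hp).2
    have a' := hf p' (mem_filter.1 hp').2
    rw [← he] at a'
    by_contra hne
    exact (mem_filter.1 a.1).2 (mem_range_planeLine hne a.2 a'.2)
  have h3 := (card_le_card hsub).trans (card_union_le _ _)
  omega

/-- In an affine space of odd order `q`, any two or more lines together with the points that they
cover an odd number of times number at least `2 q`. -/
theorem two_mul_le_card_add_card_oddSet (hF : Odd (Fintype.card F)) (C : Finset (Line F m))
    (hC : 2 ≤ #C) : 2 * Fintype.card F ≤ #C + #(oddSet C) := by
  by_cases h : ∃ L ∈ C, ∃ M ∈ C, L ≠ M ∧ ∃ o, o ∈ L.1 ∧ o ∈ M.1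
  · obtain ⟨L, hL, M, hM, hne, o, hoL, hoM⟩ := h
    obtain ⟨u, hu, hLu⟩ := L.exists_eq_lineThrough hoL
    obtain ⟨v, hv, hMv⟩ := M.exists_eq_lineThrough hoM
    have huv : LinearIndependent F ![u, v] := by
      rw [LinearIndependent.pair_iff' hu]
      rintro a rfl
      refine hne (Line.eq_of_mem_of_mem (p := o) (p' := o + a • u) (by simpa using hv)
        hoL ?_ hoM ?_)
      · exact hLu ▸ mem_lineThrough.2 ⟨a, rfl⟩
      · exact hMv ▸ mem_lineThrough.2 ⟨1, by simp⟩
    refine le_trans ?_ (card_add_card_oddPoints_le o huv C)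
    refine two_mul_le_card_add_card_oddPoints (fun _ _ => slopeCoord_bijective) rfl
      (by simp) hF _ ?_
    have h1 : planeLine o huv (some 0, 0) = L := by
      rw [hLu, planeLine]
      congr 1 <;> simp
    have h2 : planeLine o huv (none, 0) = M := by
      rw [hMv, planeLine]
      congr 1; simp
    calc 2 = #{((some 0, 0) : Option F × F), (none, 0)} := (card_pair (by simp)).symm
      _ ≤ _ := card_le_card fun l hl => by
        simp only [mem_insert, mem_singleton] at hl
        rcases hl with rfl | rfl <;> simp [h1, h2, hL, hM]
  · push Not at h
    -- pairwise disjoint lines: every point of every line is covered once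
    have hsum : #C * Fintype.card F ≤ #(oddSet C) := by
      calc #C * Fintype.card F = ∑ L ∈ C, #{p : Point F m | p ∈ L.1} := by
            simp [card_points_line]
        _ = #(C.biUnion fun L => {p : Point F m | p ∈ L.1}) := by
            refine (card_biUnion fun L hL M hM hne => ?_).symm
            refine disjoint_left.2 ?_
            intro p hp hp'
            exact h L hL M hM hne p (mem_filter.1 hp).2 (mem_filter.1 hp').2
        _ ≤ #(oddSet C) := card_le_card fun p hp => by
            simp only [mem_biUnion, mem_filter, mem_univ, true_and] at hp
            obtain ⟨L, hL, hp⟩ := hp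
            have : ({M ∈ C | p ∈ M.1} : Finset (Line F m)) = {L} := by
              ext M
              simp only [mem_filter, mem_singleton]
              refine ⟨fun hM => ?_, by rintro rfl; exact ⟨hL, hp⟩⟩
              by_contra hne
              exact h M hM.1 L hL hne p hM.2 hp
            simp [oddSet, this]
    nlinarith

end Plane

/-! ### The extended incidence matrix and its code -/

section Matrix

variable {F : Type*} [Field F] [Fintype F] {m : ℕ}

theorem sum_agMatrix_mul_agMatrix (p p' : Point F m) :
    ∑ L, agMatrix F m p L * agMatrix F m p' L = (#{L : Line F m | p ∈ L.1 ∧ p' ∈ L.1} : ZMod 2) := by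
  rw [card_filter, Nat.cast_sum]
  refine sum_congr rfl fun L _ => ?_
  by_cases h : p ∈ L.1 <;> by_cases h' : p' ∈ L.1 <;> simp [agMatrix, h, h']

/-- Every point of the extended design is on an odd number of blocks, and two distinct points are
on exactly one common block. -/
theorem extMatrix_mul_transpose (hm : Even m) (hF : Odd (Fintype.card F)) :
    extMatrix F m * (extMatrix F m).transpose = Matrix.of fun _ _ => 1 := by
  have hq : ((Fintype.card F : ℕ) : ZMod 2) = 1 := (ZMod.natCast_eq_one_iff_odd).2 hF
  ext i j
  rw [extMatrix, Matrix.fromBlocks_transpose, Matrix.fromBlocks_multiply]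
  rcases i with p | _ <;> rcases j with p' | _
  · have hsum : (agMatrix F m * (agMatrix F m).transpose) p p' =
        (#{L : Line F m | p ∈ L.1 ∧ p' ∈ L.1} : ZMod 2) := sum_agMatrix_mul_agMatrix p p'
    simp only [Matrix.transpose_one, mul_one, Matrix.fromBlocks_apply₁₁, Matrix.add_apply, hsum,
      Matrix.of_apply]
    by_cases h : p = p'
    · subst h
      have := (ZMod.natCast_eq_zero_iff_even).2 (even_card_lines_through hm hF p)
      simp only [and_self, this, Matrix.one_apply_eq, add_zero]
    · rw [card_lines_through_two h, Matrix.one_apply_ne h]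
      simp
  · simp
  · simp
  · simp [Matrix.mul_apply, hq]

theorem rank_extMatrix_mul_transpose (hm : Even m) (hF : Odd (Fintype.card F)) :
    (extMatrix F m * (extMatrix F m).transpose).rank = 1 := by
  rw [extMatrix_mul_transpose hm hF]
  refine le_antisymm ?_ (Nat.one_le_iff_ne_zero.2 fun h => ?_)
  · have : (Matrix.of fun _ _ => 1 : Matrix (Point F m ⊕ Unit) (Point F m ⊕ Unit) (ZMod 2)) =
        Matrix.vecMulVec (fun _ => 1) (fun _ => 1) := by
      ext
      simp [Matrix.vecMulVec]
    rw [this]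
    exact Matrix.rank_vecMulVec_le _ _
  · rw [Matrix.rank, Submodule.finrank_eq_zero, LinearMap.range_eq_bot] at h
    simpa using congrFun (LinearMap.congr_fun h (Pi.single (Sum.inr ()) 1)) (Sum.inr ())

/-- The rows of the extended incidence matrix are linearly independent. -/
theorem extMatrix_transpose_mulVec_injective (hF : Odd (Fintype.card F)) (hm : 1 ≤ m) :
    Function.Injective (extMatrix F m).transpose.mulVec := by
  have hq : ((Fintype.card F : ℕ) : ZMod 2) = 1 := (ZMod.natCast_eq_one_iff_odd).2 hF
  refine (injective_iff_map_eq_zero (extMatrix F m).transpose.mulVecLin).2 fun y hy => ?_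
  replace hy : (extMatrix F m).transpose.mulVec y = 0 := hy
  have h1 : ∀ p, y (Sum.inl p) + y (Sum.inr ()) = 0 := fun p => by
    simpa [extMatrix, Matrix.mulVec, dotProduct, Matrix.one_apply] using congrFun hy (Sum.inl p)
  have h2 : ∀ p, y (Sum.inl p) = y (Sum.inr ()) := fun p => CharTwo.add_eq_zero.1 (h1 p)
  have h3 : y (Sum.inr ()) = 0 := by
    have : Nonempty (Fin m) := ⟨⟨0, hm⟩⟩
    obtain ⟨p, p', hp⟩ := exists_pair_ne (Point F m)
    obtain ⟨L, -⟩ := exists_line hp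
    have := congrFun hy (Sum.inr L)
    simpa [extMatrix, Matrix.mulVec, dotProduct, agMatrix, h2,
      ← sum_filter, card_points_line, hq] using this
  ext (p | _)
  · rw [h2, h3]; rfl
  · exact h3

theorem rank_extMatrix (hF : Odd (Fintype.card F)) (hm : 1 ≤ m) :
    (extMatrix F m).rank = Fintype.card F ^ m + 1 := by
  rw [← Matrix.rank_transpose, Matrix.rank,
    LinearMap.finrank_range_of_inj (extMatrix_transpose_mulVec_injective hF hm)]
  simp

theorem finrank_code_extMatrix (hF : Odd (Fintype.card F)) (hm : 1 ≤ m) :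
    Module.finrank (ZMod 2) (code (extMatrix F m)) + 1 = Fintype.card (Line F m) := by
  have h := LinearMap.finrank_range_add_finrank_ker (extMatrix F m).mulVecLin
  have h2 := rank_extMatrix (m := m) hF hm
  rw [Matrix.rank] at h2
  rw [h2] at h
  simp only [Module.finrank_fintype_fun_eq_card, Fintype.card_sum, Fintype.card_fun,
    Fintype.card_fin] at h
  rw [code]
  omega

/-- A codeword amounts to a set of lines together with the set of its odd points, of even size:
the checks of the points of the affine geometry and the check of `∞`. -/
theorem mem_code_extMatrix {x : Point F m ⊕ Line F m → ZMod 2} :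
    x ∈ code (extMatrix F m) ↔
      oddSet {L | x (Sum.inr L) ≠ 0} = ({p | x (Sum.inl p) ≠ 0} : Finset (Point F m)) ∧
      Even #{p | x (Sum.inl p) ≠ 0} := by
  have h01 : ∀ a : ZMod 2, a = if a ≠ 0 then 1 else 0 := fun a => by
    fin_cases a <;> rfl
  have hp : ∀ p, (extMatrix F m).mulVec x (Sum.inl p) =
      x (Sum.inl p) + (#{L ∈ ({L | x (Sum.inr L) ≠ 0} : Finset (Line F m)) | p ∈ L.1} : ZMod 2) := by
    intro p
    simp only [extMatrix, Matrix.mulVec, dotProduct, Fintype.sum_sum_type,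
      Matrix.fromBlocks_apply₁₁, Matrix.fromBlocks_apply₁₂, Matrix.one_apply, ite_mul, one_mul,
      zero_mul, sum_ite_eq, mem_univ, if_true, agMatrix, Matrix.of_apply]
    rw [filter_filter, card_filter, Nat.cast_sum]
    congr 1
    refine sum_congr rfl fun L _ => ?_
    rw [h01 (x (Sum.inr L))]
    by_cases h : p ∈ L.1 <;> by_cases h' : x (Sum.inr L) = 0 <;> simp [h, h']
  have hi : (extMatrix F m).mulVec x (Sum.inr ()) = (#{p | x (Sum.inl p) ≠ 0} : ZMod 2) := by
    simp only [extMatrix, Matrix.mulVec, dotProduct, Fintype.sum_sum_type,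
      Matrix.fromBlocks_apply₂₁, Matrix.fromBlocks_apply₂₂, Matrix.zero_apply, zero_mul,
      sum_const_zero, add_zero, one_mul, Matrix.of_apply]
    rw [card_filter, Nat.cast_sum]
    refine sum_congr rfl fun p _ => ?_
    rw [Nat.cast_ite, Nat.cast_one, Nat.cast_zero]
    exact h01 _
  rw [code, LinearMap.mem_ker, Matrix.mulVecLin_apply, funext_iff, Sum.forall]
  refine and_congr ?_ ?_
  · rw [Finset.ext_iff]
    refine forall_congr' fun p => ?_
    rw [hp, Pi.zero_apply, CharTwo.add_eq_zero, oddSet, mem_filter, mem_filter]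
    simp only [mem_univ, true_and]
    rw [← ZMod.natCast_eq_one_iff_odd]
    generalize ((#{L ∈ ({L | x (Sum.inr L) ≠ 0} : Finset (Line F m)) | p ∈ L.1} : ℕ) : ZMod 2) = a
    generalize x (Sum.inl p) = b
    revert a b
    decide
  · simp only [Unique.forall_iff, hi, Pi.zero_apply,
      ZMod.natCast_eq_zero_iff_even]

theorem hammingNorm_eq (x : Point F m ⊕ Line F m → ZMod 2) :
    hammingNorm x = #{L : Line F m | x (Sum.inr L) ≠ 0} + #{p : Point F m | x (Sum.inl p) ≠ 0} := by
  rw [hammingNorm, card_filter, Fintype.sum_sum_type, ← card_filter, ← card_filter, add_comm]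

theorem two_mul_le_hammingNorm (hF : Odd (Fintype.card F)) {x : Point F m ⊕ Line F m → ZMod 2}
    (hx : x ∈ code (extMatrix F m)) (h0 : x ≠ 0) : 2 * Fintype.card F ≤ hammingNorm x := by
  rw [mem_code_extMatrix] at hx
  obtain ⟨hx, hev⟩ := hx
  rw [hammingNorm_eq, ← hx]
  rw [← hx] at hev
  refine two_mul_le_card_add_card_oddSet hF _ ?_
  by_contra! hlt
  obtain hC | hC : #{L : Line F m | x (Sum.inr L) ≠ 0} = 0 ∨
    #{L : Line F m | x (Sum.inr L) ≠ 0} = 1 := by omega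
  · rw [card_eq_zero] at hC
    rw [hC] at hx
    refine h0 (funext fun i => ?_)
    rcases i with p | L
    · by_contra hp
      have : p ∈ oddSet (∅ : Finset (Line F m)) := by
        rw [hx, mem_filter]
        exact ⟨mem_univ p, hp⟩
      simp [oddSet] at this
    · by_contra hL
      have : L ∈ (∅ : Finset (Line F m)) := by
        rw [← hC]
        simpa using hL
      simp at this
  · -- the odd points of a single line are its points, and there are an odd number of them
    obtain ⟨L, hL⟩ := card_eq_one.1 hC
    have h2 : oddSet {L} = ({p | p ∈ L.1} : Finset (Point F m)) := by
      ext p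
      by_cases h : p ∈ L.1 <;> simp [oddSet, filter_singleton, h]
    rw [hL, h2, card_points_line] at hev
    exact Nat.not_even_iff_odd.2 hF hev

/-- Two parallel classes of a plane form a codeword. -/
theorem exists_hammingNorm_eq (hm : 2 ≤ m) :
    ∃ x ∈ code (extMatrix F m), x ≠ 0 ∧ hammingNorm x = 2 * Fintype.card F := by
  obtain ⟨u, v, huv⟩ : ∃ u v : Point F m, LinearIndependent F ![u, v] := by
    have hne : (⟨0, by omega⟩ : Fin m) ≠ ⟨1, by omega⟩ := by simp
    refine ⟨Pi.single ⟨0, by omega⟩ 1, Pi.single ⟨1, by omega⟩ 1,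
      LinearIndependent.pair_iff.2 fun s t h => ⟨?_, ?_⟩⟩
    · simpa [hne] using congrFun h ⟨0, by omega⟩
    · simpa [hne.symm] using congrFun h ⟨1, by omega⟩
  set C : Finset (Line F m) :=
    (({some 0, none} : Finset (Option F)) ×ˢ (univ : Finset F)).image (planeLine 0 huv) with hC
  have hcard : #C = 2 * Fintype.card F := by
    rw [hC, card_image_of_injective _ (planeLine_injective 0 huv), card_product, card_pair (by simp),
      card_univ]
  have hodd : oddSet C = ∅ := by
    refine filter_eq_empty_iff.2 fun x _ => Nat.not_odd_iff_even.2 ?_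
    by_cases hx : ∃ p, planePoint 0 u v p = x
    · obtain ⟨p, rfl⟩ := hx
      have : ({L ∈ C | planePoint 0 u v p ∈ L.1} : Finset (Line F m)) =
          {planeLine 0 huv (some 0, p.2), planeLine 0 huv (none, p.1)} := by
        ext L
        simp only [hC, mem_filter, mem_image, mem_product, mem_univ, and_true, mem_insert,
          mem_singleton, Prod.exists]
        constructor
        · rintro ⟨⟨δ, b, hδ | hδ, rfl⟩, h⟩ <;> subst hδ <;> rw [planePoint_mem_planeLine] at h <;>
            simp only [slopeCoord] at h <;> simp [← h]
        · rintro (rfl | rfl)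
          · exact ⟨⟨_, _, Or.inl rfl, rfl⟩, planePoint_mem_planeLine.2 (by simp [slopeCoord])⟩
          · exact ⟨⟨_, _, Or.inr rfl, rfl⟩, planePoint_mem_planeLine.2 (by simp [slopeCoord])⟩
      rw [this, card_pair ((planeLine_injective 0 huv).ne (by simp))]
      exact even_two
    · have : ({L ∈ C | x ∈ L.1} : Finset (Line F m)) = ∅ := by
        refine filter_eq_empty_iff.2 fun L hL hxL => hx ?_
        obtain ⟨l, -, rfl⟩ := mem_image.1 hL
        obtain ⟨p, -, hp⟩ := mem_planeLine.1 hxL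
        exact ⟨p, hp⟩
      simp [this]
  set x : Point F m ⊕ Line F m → ZMod 2 := Sum.elim 0 (fun L => if L ∈ C then 1 else 0) with hx
  have hxC : ({L | x (Sum.inr L) ≠ 0} : Finset (Line F m)) = C := by
    ext L
    simp [hx]
  have hx0 : ({p | x (Sum.inl p) ≠ 0} : Finset (Point F m)) = ∅ := by
    ext p
    simp [hx]
  have hnorm : hammingNorm x = 2 * Fintype.card F := by
    rw [hammingNorm_eq, hxC, hx0, hcard, card_empty, add_zero]
  refine ⟨x, ?_, ?_, hnorm⟩
  · rw [mem_code_extMatrix, hxC, hx0]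
    exact ⟨hodd, by simp⟩
  · rw [← hammingNorm_ne_zero_iff, hnorm]
    have := Fintype.card_pos (α := F)
    omega

theorem isMinDist_code_extMatrix (hm : 2 ≤ m) (hF : Odd (Fintype.card F)) :
    IsMinDist (code (extMatrix F m)) (2 * Fintype.card F) := by
  constructor
  · obtain ⟨x, hx, h0, hn⟩ := exists_hammingNorm_eq (F := F) hm
    refine ⟨x, hx, 0, Submodule.zero_mem _, h0, ?_⟩
    convert hn
    convert hammingDist_zero_right x
  · rintro e ⟨x, hx, y, hy, hne, rfl⟩
    have := two_mul_le_hammingNorm hF (Submodule.sub_mem _ hy hx) (sub_ne_zero.2 hne.symm)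
    rw [sub_eq_neg_add, ← hammingDist_eq_hammingNorm] at this
    convert this

end Matrix

/-! ### The girth of the Tanner graph -/

section Girth


theorem tannerGraph_adj_inl_inr {R N : Type*} {H : Matrix R N (ZMod 2)} {r : R} {n : N} :
    (tannerGraph H).Adj (Sum.inl r) (Sum.inr n) ↔ H r n = 1 := by
  simp [tannerGraph]

theorem tannerGraph_adj_inr_inl {R N : Type*} {H : Matrix R N (ZMod 2)} {r : R} {n : N} :
    (tannerGraph H).Adj (Sum.inr n) (Sum.inl r) ↔ H r n = 1 := by
  rw [SimpleGraph.adj_comm, tannerGraph_adj_inl_inr]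

theorem tannerGraph_isLeft_ne {R N : Type*} {H : Matrix R N (ZMod 2)} {a b : R ⊕ N}
    (h : (tannerGraph H).Adj a b) : a.isLeft = !b.isLeft := by
  rcases a with a | a <;> rcases b with b | b <;> simp [tannerGraph] at h ⊢

/-- If no two columns of `H` share two ones, then the Tanner graph of `H` has no cycle shorter
than `6`. -/
theorem six_le_length_of_isCycle {R N : Type*} {H : Matrix R N (ZMod 2)}
    (hH : ∀ r r' n n', r ≠ r' → H r n = 1 → H r' n = 1 → H r n' = 1 → H r' n' = 1 → n = n')
    {a : R ⊕ N} {w : (tannerGraph H).Walk a a} (hw : w.IsCycle) : 6 ≤ w.length := by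
  -- checks and bits alternate along the cycle
  have hpar : ∀ i ≤ w.length, (w.getVert i).isLeft = (a.isLeft ^^ decide (i % 2 = 1)) := by
    intro i
    induction i with
    | zero => simp
    | succ i ih =>
      intro hi
      have h := tannerGraph_isLeft_ne (w.adj_getVert_succ (by omega : i < w.length))
      rw [ih (by omega)] at h
      rcases Nat.mod_two_eq_zero_or_one i with h2 | h2
      · rw [show (i + 1) % 2 = 1 by omega]
        rw [h2] at h
        generalize (w.getVert (i + 1)).isLeft = c at h ⊢
        generalize a.isLeft = d at h ⊢
        revert c d
        decide
      · rw [show (i + 1) % 2 = 0 by omega]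
        rw [h2] at h
        generalize (w.getVert (i + 1)).isLeft = c at h ⊢
        generalize a.isLeft = d at h ⊢
        revert c d
        decide
  have heven : w.length % 2 = 0 := by
    have h := hpar w.length le_rfl
    rw [w.getVert_length] at h
    by_contra hc
    rw [show w.length % 2 = 1 by omega] at h
    generalize a.isLeft = d at h
    revert d
    decide
  have h3 := hw.three_le_length
  by_contra! hlt
  have h4 : w.length = 4 := by omega
  have adj := fun i (hi : i < w.length) => w.adj_getVert_succ hi
  have a0 := adj 0 (by omega)
  have a1 := adj 1 (by omega)
  have a2 := adj 2 (by omega)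
  have a3 := adj 3 (by omega)
  have he : w.getVert 4 = w.getVert 0 := by rw [← h4, w.getVert_length, w.getVert_zero]
  have hinj := hw.getVert_injOn'
  -- a cycle of length `4` consists of two checks and two bits common to them
  have n02 : w.getVert 0 ≠ w.getVert 2 := fun h => by
    have := hinj (by simp) (by simp; omega) h
    omega
  have n13 : w.getVert 1 ≠ w.getVert 3 := fun h => by
    have := hinj (by simp; omega) (by simp; omega) h
    omega
  simp only [Nat.reduceAdd, he] at a0 a1 a2 a3
  generalize w.getVert 0 = v0 at *
  generalize w.getVert 1 = v1 at *
  generalize w.getVert 2 = v2 at *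
  generalize w.getVert 3 = v3 at *
  have b0 := tannerGraph_isLeft_ne a0
  have b1 := tannerGraph_isLeft_ne a1
  have b2 := tannerGraph_isLeft_ne a2
  rcases v0 with v0 | v0 <;> rcases v1 with v1 | v1 <;> simp at b0 <;>
    rcases v2 with v2 | v2 <;> simp at b1 <;> rcases v3 with v3 | v3 <;> simp at b2
  · simp only [tannerGraph_adj_inl_inr, tannerGraph_adj_inr_inl] at a0 a1 a2 a3
    exact n13 (congrArg _ (hH v0 v2 v1 v3 (by simpa using n02) a0 a1 a3 a2))
  · simp only [tannerGraph_adj_inl_inr, tannerGraph_adj_inr_inl] at a0 a1 a2 a3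
    exact n02 (congrArg _ (hH v1 v3 v0 v2 (by simpa using n13) a0 a3 a1 a2))

variable {F : Type*} [Field F] [Fintype F] {m : ℕ}

theorem extMatrix_inl_inl {p p' : Point F m} :
    extMatrix F m (Sum.inl p) (Sum.inl p') = 1 ↔ p = p' := by
  simp [extMatrix, Matrix.one_apply]

theorem extMatrix_inl_inr {p : Point F m} {L : Line F m} :
    extMatrix F m (Sum.inl p) (Sum.inr L) = 1 ↔ p ∈ L.1 := by
  simp [extMatrix, agMatrix]

theorem extMatrix_inr_inl {p : Point F m} {i : Unit} :
    extMatrix F m (Sum.inr i) (Sum.inl p) = 1 := by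
  simp [extMatrix]

theorem extMatrix_inr_inr {L : Line F m} {i : Unit} :
    extMatrix F m (Sum.inr i) (Sum.inr L) ≠ 1 := by
  simp [extMatrix]

/-- Two distinct points of the extended design have at most one common block. -/
theorem extMatrix_block_unique (r r' : Point F m ⊕ Unit) (n n' : Point F m ⊕ Line F m)
    (h : r ≠ r') (h1 : extMatrix F m r n = 1) (h2 : extMatrix F m r' n = 1)
    (h3 : extMatrix F m r n' = 1) (h4 : extMatrix F m r' n' = 1) : n = n' := by
  rcases r with p | _ <;> rcases r' with p' | _ <;> rcases n with x | L <;>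
    rcases n' with x' | L' <;>
    simp only [extMatrix_inl_inl, extMatrix_inl_inr, extMatrix_inr_inl, extMatrix_inr_inr]
      at h1 h2 h3 h4 <;> first | (subst_vars; simp at h; done) | (subst_vars; rfl) | skip
  exact congrArg _ (Line.eq_of_mem_of_mem (by simpa using h) h1 h2 h3 h4)

/-- The point `∞`, two points `p`, `p'` of the affine geometry and the three blocks that join them
form a cycle of length `6`. -/
theorem girth_tannerGraph_extMatrix (hm : 1 ≤ m) : (tannerGraph (extMatrix F m)).girth = 6 := by
  have : Nonempty (Fin m) := ⟨⟨0, hm⟩⟩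
  obtain ⟨p, p', hp⟩ := exists_pair_ne (Point F m)
  obtain ⟨L, hL, hL'⟩ := exists_line hp
  set G := tannerGraph (extMatrix F m) with hG
  have e1 : G.Adj (Sum.inl (Sum.inr ())) (Sum.inr (Sum.inl p)) :=
    tannerGraph_adj_inl_inr.2 extMatrix_inr_inl
  have e2 : G.Adj (Sum.inr (Sum.inl p)) (Sum.inl (Sum.inl p)) :=
    tannerGraph_adj_inr_inl.2 (extMatrix_inl_inl.2 rfl)
  have e3 : G.Adj (Sum.inl (Sum.inl p)) (Sum.inr (Sum.inr L)) :=
    tannerGraph_adj_inl_inr.2 (extMatrix_inl_inr.2 hL)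
  have e4 : G.Adj (Sum.inr (Sum.inr L)) (Sum.inl (Sum.inl p')) :=
    tannerGraph_adj_inr_inl.2 (extMatrix_inl_inr.2 hL')
  have e5 : G.Adj (Sum.inl (Sum.inl p')) (Sum.inr (Sum.inl p')) :=
    tannerGraph_adj_inl_inr.2 (extMatrix_inl_inl.2 rfl)
  have e6 : G.Adj (Sum.inr (Sum.inl p')) (Sum.inl (Sum.inr ())) :=
    tannerGraph_adj_inr_inl.2 extMatrix_inr_inl
  let w : G.Walk (Sum.inl (Sum.inr ())) (Sum.inl (Sum.inr ())) :=
    .cons e1 (.cons e2 (.cons e3 (.cons e4 (.cons e5 (.cons e6 .nil)))))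
  have hw : w.IsCycle := by
    rw [SimpleGraph.Walk.cons_isCycle_iff]
    simp [SimpleGraph.Walk.cons_isPath_iff, hp]
  refine le_antisymm hw.girth_le_length ?_
  obtain ⟨a, v, hv, hlen⟩ := SimpleGraph.exists_girth_eq_length.2 fun h => h w hw
  rw [hlen]
  exact six_le_length_of_isCycle extMatrix_block_unique hv

end Girth

/-! ### Measurements and orthogonality -/

section Measurement


/-- Pairwise orthogonal subspaces are distinguished by a projective measurement. The projection of
one outcome `i₀` absorbs the orthogonal complement of all the subspaces. -/
theorem exists_measurement {ι E : Type*} [Fintype ι] [Nonempty ι] [NormedAddCommGroup E]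
    [InnerProductSpace ℂ E] [FiniteDimensional ℂ E] [CompleteSpace E] (V : ι → Submodule ℂ E)
    (hV : ∀ i j, i ≠ j → V i ⟂ V j) :
    ∃ P : ι → (E →L[ℂ] E), (∀ i, IsStarProjection (P i)) ∧ (∀ i j, i ≠ j → P i * P j = 0) ∧
      ∑ i, P i = 1 ∧ ∀ i, ∀ v ∈ V i, P i v = v := by
  obtain ⟨i₀⟩ := ‹Nonempty ι›
  set Q : ι → (E →L[ℂ] E) := fun i => (V i).starProjection with hQ
  have hstar : ∀ i, IsStarProjection (Q i) := fun i => isStarProjection_starProjection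
  have hmul : ∀ i j, i ≠ j → Q i * Q j = 0 := fun i j h =>
    (hV i j h).starProjection_comp_starProjection
  -- the projection onto the sum of the other subspaces
  set A : E →L[ℂ] E := ∑ j ∈ univ.erase i₀, Q j with hA
  have hQA : ∀ i, i ≠ i₀ → Q i * A = Q i := fun i hi => by
    rw [hA, mul_sum, sum_eq_single_of_mem i (by simp [hi]) fun j _ hj => hmul i j hj.symm]
    exact (hstar i).isIdempotentElem
  have hAQ : ∀ i, i ≠ i₀ → A * Q i = Q i := fun i hi => by
    rw [hA, sum_mul, sum_eq_single_of_mem i (by simp [hi]) fun j _ hj => hmul j i hj]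
    exact (hstar i).isIdempotentElem
  have hAstar : IsStarProjection A := by
    refine ⟨?_, ?_⟩
    · change A * A = A
      nth_rewrite 1 [hA]
      rw [sum_mul, hA]
      exact sum_congr rfl fun i hi => hQA i (ne_of_mem_erase hi)
    · rw [IsSelfAdjoint, hA, star_sum]
      exact sum_congr rfl fun i _ => (hstar i).isSelfAdjoint
  refine ⟨fun i => if i = i₀ then 1 - A else Q i, fun i => ?_, fun i j hij => ?_, ?_,
    fun i v hv => ?_⟩
  · dsimp only
    split_ifs
    · exact hAstar.one_sub
    · exact hstar i
  · dsimp only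
    split_ifs with h h' h'
    · exact absurd (h.trans h'.symm) hij
    · rw [sub_mul, hAQ j h', one_mul, sub_self]
    · rw [mul_sub, hQA i h, mul_one, sub_self]
    · exact hmul i j hij
  · rw [← add_sum_erase _ _ (mem_univ i₀), if_pos rfl, hA,
      sum_congr rfl fun i hi => if_neg (ne_of_mem_erase hi), sub_add_cancel]
  · dsimp only
    split_ifs with h
    · subst h
      have : A v = 0 := by
        rw [hA, _root_.sum_apply]
        refine sum_eq_zero fun j hj => ?_
        rw [hQ, Submodule.starProjection_apply_eq_zero_iff]
        exact (hV j i (ne_of_mem_erase hj)).symm hv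
      simp [this]
    · exact Submodule.starProjection_eq_self_iff.2 hv

variable {N R : Type*} [Fintype N] [Fintype R] {k c : ℕ}

/-- For decoding it is enough that errors with different syndromes take the encoded states to
orthogonal ones: the outcomes belong to the spans of the corrupted states. -/
theorem Code.decodedBy_of_orthogonal (Q : Code N k c) (H : Matrix R N (ZMod 2))
    (h : ∀ eX eZ eX' eZ' ψ ψ', (H.mulVec eX, H.mulVec eZ) ≠ (H.mulVec eX', H.mulVec eZ') →
      inner ℂ (pauli eX eZ (Q.encode ψ)) (pauli eX' eZ' (Q.encode ψ')) = 0) :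
    Q.DecodedBy H := by
  obtain ⟨P, h1, h2, h3, h4⟩ := exists_measurement
    (fun s : (R → ZMod 2) × (R → ZMod 2) => Submodule.span ℂ
      {Φ | ∃ eX eZ ψ, (H.mulVec eX, H.mulVec eZ) = s ∧ Φ = pauli eX eZ (Q.encode ψ)}) (by
      intro s t hst
      rw [Submodule.isOrtho_span]
      rintro _ ⟨eX, eZ, ψ, rfl, rfl⟩ _ ⟨eX', eZ', ψ', rfl, rfl⟩
      exact h _ _ _ _ _ _ hst)
  exact ⟨P, h1, h2, h3, fun eX eZ ψ =>
    h4 _ _ (Submodule.subset_span ⟨eX, eZ, ψ, rfl, rfl⟩)⟩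

theorem Code.DecodedBy.orthogonal {Q : Code N k c} {H : Matrix R N (ZMod 2)} (h : Q.DecodedBy H)
    {eX eZ eX' eZ' : Bits N} {ψ ψ' : Hilb (Bits (Fin k))}
    (hne : (H.mulVec eX, H.mulVec eZ) ≠ (H.mulVec eX', H.mulVec eZ')) :
    inner ℂ (pauli eX eZ (Q.encode ψ)) (pauli eX' eZ' (Q.encode ψ')) = 0 := by
  obtain ⟨P, h1, h2, -, h4⟩ := h
  rw [← h4 eX eZ ψ, ← h4 eX' eZ' ψ', ← ContinuousLinearMap.adjoint_inner_right,
    ← ContinuousLinearMap.star_eq_adjoint, (h1 _).isSelfAdjoint.star_eq,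
    ← mul_apply_eq_comp, h2 _ _ hne]
  simp

end Measurement

/-! ### The bound for codes without ebits -/

section Pauli


theorem neg_one_pow_val_add (a b : ZMod 2) :
    (-1 : ℂ) ^ (a + b).val = (-1) ^ a.val * (-1) ^ b.val := by
  rw [← pow_add, ZMod.val_add]
  exact (neg_one_pow_eq_pow_mod_two _).symm

variable {N B : Type*} [Fintype N] [Fintype B]

theorem inner_pauli_pauli (eX eZ : Bits N) (Φ Ψ : Hilb (Bits N × B)) :
    inner ℂ (pauli eX eZ Φ) (pauli eX eZ Ψ) = inner ℂ Φ Ψ := by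
  simp only [PiLp.inner_apply]
  refine Fintype.sum_equiv ((Equiv.subRight eX).prodCongr (Equiv.refl B)) _ _ fun p => ?_
  have h : (-1 : ℂ) ^ (eZ ⬝ᵥ (p.1 - eX)).val * (-1) ^ (eZ ⬝ᵥ (p.1 - eX)).val = 1 := by
    rw [← mul_pow]
    simp
  simp only [pauli, RCLike.inner_apply, map_mul, map_pow, map_neg, map_one, Equiv.prodCongr_apply,
    Prod.map, Equiv.subRight_apply, Equiv.refl_apply]
  linear_combination (Ψ (p.1 - eX, p.2) * (starRingEnd ℂ) (Φ (p.1 - eX, p.2))) * h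

theorem inner_encode_of_no_ebits {k : ℕ} (Q : Code N k 0) (ψ ψ' : Hilb (Bits (Fin k))) :
    inner ℂ (Q.encode ψ) (Q.encode ψ') = inner ℂ ψ ψ' := by
  have he : ∀ p : Bits (Fin 0) × Bits (Fin 0), ebits 0 p = 1 := fun p => by
    simp [ebits, Subsingleton.elim p.1 p.2]
  have h1 : inner ℂ (Q.encode ψ) (Q.encode ψ') =
      inner ℂ (Q.enc (WithLp.toLp 2 fun a => ψ a.1)) (Q.enc (WithLp.toLp 2 fun a => ψ' a.1)) := by
    simp only [PiLp.inner_apply, Code.encode, he, mul_one, Fintype.sum_prod_type]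
    simp
  rw [h1, LinearIsometry.inner_map_map]
  simp only [PiLp.inner_apply, Fintype.sum_prod_type]
  simp

/-- Without ebits, the images of the code space under errors with different syndromes are pairwise
orthogonal subspaces of dimension `2 ^ k`, and there are `2 ^ (2 r)` syndromes. -/
theorem Code.DecodedBy.add_two_mul_card_le {R : Type*} [Fintype R] {k : ℕ} {Q : Code N k 0}
    {H : Matrix R N (ZMod 2)} (h : Q.DecodedBy H) (hH : Function.Surjective H.mulVec) :
    k + 2 * Fintype.card R ≤ Fintype.card N := by
  obtain ⟨e, he⟩ := hH.hasRightInverse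
  have horth : Orthonormal ℂ fun i : ((R → ZMod 2) × (R → ZMod 2)) × Bits (Fin k) =>
      pauli (e i.1.1) (e i.1.2) (Q.encode (EuclideanSpace.single i.2 1)) := by
    rw [orthonormal_iff_ite]
    rintro ⟨s, a⟩ ⟨t, b⟩
    by_cases hst : s = t
    · subst hst
      rw [inner_pauli_pauli, inner_encode_of_no_ebits,
        orthonormal_iff_ite.1 EuclideanSpace.orthonormal_single a b]
      simp
    · rw [h.orthogonal (by simpa [he _, Prod.ext_iff] using hst), if_neg fun h => hst (by simp_all)]
  have hcard := horth.linearIndependent.fintype_card_le_finrank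
  simp only [Fintype.card_prod, Fintype.card_fun, ZMod.card, Fintype.card_fin,
    finrank_euclideanSpace, pow_zero, mul_one, ← pow_add] at hcard
  have := (Nat.pow_le_pow_iff_right (by norm_num : 1 < 2)).1 hcard
  omega

end Pauli

/-! ### Construction of the code with one ebit -/

section Encoder


variable {N R : Type*}

/-- The syndrome map of the binary matrix `[H 1]`, the matrix `H` with an additional all-one column
that stands for the receiver's qubit. -/
def checkMap [Fintype N] (H : Matrix R N (ZMod 2)) :
    (Bits N × Bits (Fin 1)) →ₗ[ZMod 2] (R → ZMod 2) where
  toFun p := H.mulVec p.1 + fun _ => p.2 0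
  map_add' p p' := by
    ext r
    simp [Matrix.mulVec_add]
    ring
  map_smul' a p := by
    ext r
    simp [Matrix.mulVec_smul, mul_add]

/-- The linear combinations of the rows of `[H 1]`. -/
def rowMap [Fintype R] (H : Matrix R N (ZMod 2)) :
    (R → ZMod 2) →ₗ[ZMod 2] (Bits N × Bits (Fin 1)) where
  toFun y := (H.transpose.mulVec y, fun _ => ∑ r, y r)
  map_add' y y' := by
    ext
    · simp [Matrix.mulVec_add]
    · simp [sum_add_distrib]
  map_smul' a y := by
    ext
    · simp [Matrix.mulVec_smul]
    · simp [mul_sum]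

theorem checkMap_apply [Fintype N] (H : Matrix R N (ZMod 2)) (p : Bits N × Bits (Fin 1)) :
    checkMap H p = H.mulVec p.1 + fun _ => p.2 0 := rfl

theorem rowMap_apply [Fintype R] (H : Matrix R N (ZMod 2)) (y : R → ZMod 2) :
    rowMap H y = (H.transpose.mulVec y, fun _ => ∑ r, y r) := rfl

variable [Fintype N] [Fintype R]

/-- The rows of `[H 1]` are orthogonal to each other and to themselves. -/
theorem checkMap_rowMap {H : Matrix R N (ZMod 2)}
    (hH : H * H.transpose = Matrix.of fun _ _ => 1) (y : R → ZMod 2) :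
    checkMap H (rowMap H y) = 0 := by
  ext r
  rw [checkMap_apply, rowMap_apply]
  simp only [Matrix.mulVec_mulVec, hH, Pi.add_apply, Pi.zero_apply]
  simp [Matrix.mulVec, dotProduct, CharTwo.add_self_eq_zero]

/-- The joint states stabilized by the `Z`-type and the `X`-type operators that belong to the rows
of `[H 1]`: they are supported on the kernel of the syndrome map and invariant under translation
by the rows. -/
structure IsStabilized (H : Matrix R N (ZMod 2)) (Φ : Hilb (Bits N × Bits (Fin 1))) : Prop where
  supp : ∀ p, Φ p ≠ 0 → checkMap H p = 0
  inv : ∀ y p, Φ (p + rowMap H y) = Φ p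

/-- Bit errors with different syndromes separate the supports of stabilized states; phase errors
with different syndromes give them different signs under a translation. -/
theorem IsStabilized.inner_pauli_eq_zero {H : Matrix R N (ZMod 2)}
    {Φ Ψ : Hilb (Bits N × Bits (Fin 1))} (hΦ : IsStabilized H Φ) (hΨ : IsStabilized H Ψ)
    {eX eZ eX' eZ' : Bits N}
    (hne : (H.mulVec eX, H.mulVec eZ) ≠ (H.mulVec eX', H.mulVec eZ')) :
    inner ℂ (pauli eX eZ Φ) (pauli eX' eZ' Ψ) = 0 := by
  by_cases hX : H.mulVec eX = H.mulVec eX'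
  · have hZ : H.mulVec eZ ≠ H.mulVec eZ' := fun h => hne (by rw [hX, h])
    obtain ⟨i, hi⟩ := Function.ne_iff.1 hZ
    have hsign : ∀ e : Bits N, e ⬝ᵥ H.transpose.mulVec (Pi.single i 1) = H.mulVec e i := fun e => by
      rw [Matrix.dotProduct_mulVec, Matrix.vecMul_transpose, dotProduct_single_one]
    have hval : ∀ a b : ZMod 2, a ≠ b → (-1 : ℂ) ^ a.val * (-1) ^ b.val = -1 := by
      intro a b hab
      have : a + b = 1 := by
        revert a b
        decide
      rw [← neg_one_pow_val_add, this]
      simp [ZMod.val_one]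
    have hs := hval _ _ hi
    have hshift : ∀ (e e' : Bits N) (Θ : Hilb (Bits N × Bits (Fin 1))), IsStabilized H Θ → ∀ p,
        pauli e e' Θ (p + rowMap H (Pi.single i 1)) =
          (-1) ^ (H.mulVec e' i).val * pauli e e' Θ p := by
      intro e e' Θ hΘ p
      have h1 := hΘ.inv (Pi.single i 1) (p.1 - e, p.2)
      have h2 : ((p.1 - e, p.2) : Bits N × Bits (Fin 1)) + rowMap H (Pi.single i 1) =
          ((p + rowMap H (Pi.single i 1)).1 - e, (p + rowMap H (Pi.single i 1)).2) := by
        ext <;> simp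
        ring
      have h3 : (p + rowMap H (Pi.single i 1)).1 - e =
          (p.1 - e) + H.transpose.mulVec (Pi.single i 1) := by
        rw [Prod.fst_add, rowMap_apply]
        ring
      rw [h2] at h1
      simp only [pauli]
      rw [h1, h3, dotProduct_add, neg_one_pow_val_add, hsign]
      ring
    -- translating the summation variable by a row changes the sign of every summand
    have hneg : inner ℂ (pauli eX eZ Φ) (pauli eX' eZ' Ψ) =
        -inner ℂ (pauli eX eZ Φ) (pauli eX' eZ' Ψ) := by
      simp only [PiLp.inner_apply]
      rw [← sum_neg_distrib]
      refine (Fintype.sum_equiv (Equiv.addRight (rowMap H (Pi.single i 1))) _ _ fun p => ?_).symm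
      rw [Equiv.coe_addRight, hshift _ _ _ hΦ, hshift _ _ _ hΨ]
      simp only [RCLike.inner_apply, map_mul, map_pow, map_neg, map_one]
      linear_combination (-(pauli eX' eZ' Ψ p * (starRingEnd ℂ) (pauli eX eZ Φ p))) * hs
    exact self_eq_neg.1 hneg
  · rw [PiLp.inner_apply]
    refine sum_eq_zero fun p _ => ?_
    by_contra h
    have h1 : Φ (p.1 - eX, p.2) ≠ 0 := fun h0 => h (by simp [pauli, h0])
    have h2 : Ψ (p.1 - eX', p.2) ≠ 0 := fun h0 => h (by simp [pauli, h0])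
    have h3 := (hΦ.supp _ h1).trans (hΨ.supp _ h2).symm
    simp only [checkMap_apply, add_left_inj, Matrix.mulVec_sub, sub_right_inj] at h3
    exact hX h3

theorem exists_linearIsometry_of_orthonormal {X Y : Type*} [Fintype X] [Fintype Y]
    {u : X → Hilb Y} (hu : Orthonormal ℂ u) :
    ∃ f : Hilb X →ₗᵢ[ℂ] Hilb Y, ∀ z, f z = ∑ i, z i • u i := by
  set b := (EuclideanSpace.basisFun X ℂ).toBasis with hb
  have hb' : Orthonormal ℂ b := by
    rw [hb, OrthonormalBasis.coe_toBasis]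
    exact (EuclideanSpace.basisFun X ℂ).orthonormal
  refine ⟨(b.constr ℂ u).isometryOfOrthonormal hb' ?_, fun z => ?_⟩
  · have : (b.constr ℂ u) ∘ b = u := funext fun i => b.constr_basis ℂ u i
    rwa [this]
  · rw [LinearMap.coe_isometryOfOrthonormal, Module.Basis.constr_apply_fintype]
    simp [hb]

/-- Representatives of the cosets of the row space of `[H 1]` in its dual. -/
theorem exists_coset_representatives {H : Matrix R N (ZMod 2)}
    (hH : H * H.transpose = Matrix.of fun _ _ => 1) (hinj : Function.Injective H.transpose.mulVec)
    {k : ℕ} (hk : k + 2 * Fintype.card R = Fintype.card N + 1) :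
    ∃ κ : Bits (Fin k) → Bits N × Bits (Fin 1), (∀ a, checkMap H (κ a) = 0) ∧
      ∀ a a', (∃ y, κ a' = κ a + rowMap H y) → a = a' := by
  have hrow : Function.Injective (rowMap H) := fun y y' h => hinj (Prod.mk.inj h).1
  have hsurj : Function.Surjective (checkMap H) := by
    have h1 : Function.Surjective H.mulVecLin := by
      rw [← LinearMap.range_eq_top]
      apply Submodule.eq_top_of_finrank_eq
      have h2 : H.rank = Fintype.card R := by
        rw [← Matrix.rank_transpose, Matrix.rank, LinearMap.finrank_range_of_inj hinj]
        simp
      rw [Matrix.rank] at h2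
      simpa using h2
    intro s
    obtain ⟨x, hx⟩ := h1 s
    refine ⟨(x, 0), ?_⟩
    rw [checkMap_apply, ← hx]
    ext
    simp
  set ρ := (rowMap H).codRestrict (LinearMap.ker (checkMap H)) (checkMap_rowMap hH) with hρ
  have hρinj : Function.Injective ρ := fun y y' h => hrow (congrArg Subtype.val h)
  have h1 := (checkMap H).finrank_range_add_finrank_ker
  have h2 := (LinearMap.range ρ).finrank_quotient_add_finrank
  rw [LinearMap.range_eq_top.2 hsurj, finrank_top] at h1
  rw [LinearMap.finrank_range_of_inj hρinj] at h2
  simp only [Module.finrank_fintype_fun_eq_card, Module.finrank_prod, Fintype.card_fin] at h1 h2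
  have e : (LinearMap.ker (checkMap H) ⧸ LinearMap.range ρ) ≃ₗ[ZMod 2] Bits (Fin k) :=
    LinearEquiv.ofFinrankEq _ _ (by
      rw [Module.finrank_fintype_fun_eq_card, Fintype.card_fin]
      omega)
  choose g hg using Submodule.mkQ_surjective (LinearMap.range ρ)
  refine ⟨fun a => (g (e.symm a) : Bits N × Bits (Fin 1)), fun a => (g (e.symm a)).2, ?_⟩
  rintro a a' ⟨y, hy⟩
  have h3 : g (e.symm a') = g (e.symm a) + ρ y := Subtype.ext hy
  have h4 := congrArg (LinearMap.range ρ).mkQ h3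
  have h5 : (LinearMap.range ρ).mkQ (ρ y) = 0 :=
    (Submodule.Quotient.mk_eq_zero _).2 (LinearMap.mem_range_self ρ y)
  rw [map_add, hg, hg, h5, add_zero] at h4
  exact (e.symm.injective h4).symm

/-- The coset of the row space of `[H 1]` that contains `p`. -/
noncomputable def rowCoset (H : Matrix R N (ZMod 2)) (p : Bits N × Bits (Fin 1)) :
    Finset (Bits N × Bits (Fin 1)) :=
  univ.image fun y => p + rowMap H y

theorem mem_rowCoset {H : Matrix R N (ZMod 2)} {p x : Bits N × Bits (Fin 1)} :
    x ∈ rowCoset H p ↔ ∃ y, x = p + rowMap H y := by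
  simp [rowCoset, eq_comm]

theorem add_rowMap_mem_rowCoset {H : Matrix R N (ZMod 2)} {p x : Bits N × Bits (Fin 1)}
    {y : R → ZMod 2} : x + rowMap H y ∈ rowCoset H p ↔ x ∈ rowCoset H p := by
  rw [mem_rowCoset, mem_rowCoset]
  constructor
  · rintro ⟨z, hz⟩
    exact ⟨z - y, by rw [map_sub, ← add_sub_assoc, ← hz, add_sub_cancel_right]⟩
  · rintro ⟨z, rfl⟩
    exact ⟨z + y, by rw [map_add, add_assoc]⟩

/-- A coset of the row space contains as many vectors that end in `0` as vectors that end
in `1`. -/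
theorem card_rowCoset_slice [Nonempty R] (H : Matrix R N (ZMod 2)) (p : Bits N × Bits (Fin 1))
    (j j' : Bits (Fin 1)) :
    #{x : Bits N | (x, j) ∈ rowCoset H p} = #{x : Bits N | (x, j') ∈ rowCoset H p} := by
  obtain ⟨i⟩ := ‹Nonempty R›
  set y : R → ZMod 2 := Pi.single i (j' 0 - j 0) with hy
  have hrow : rowMap H y = (H.transpose.mulVec y, j' - j) := by
    rw [rowMap_apply, hy]
    ext a
    · rfl
    · rw [Fin.fin_one_eq_zero a]
      simp
  refine card_equiv (Equiv.addRight (H.transpose.mulVec y)) fun x => ?_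
  simp only [mem_filter, mem_univ, true_and, Equiv.coe_addRight]
  rw [← add_rowMap_mem_rowCoset (x := (x, j)) (y := y), hrow, Prod.mk_add_mk, add_sub_cancel]

/-- If the augmented matrix `[H 1]` has self-orthogonal and independent rows, then the CSS code
that it defines is an entanglement-assisted code with one ebit. The encoder maps the basis state
`|a, j⟩` to the normalized sum of the vectors that, extended by `j`, form the coset belonging
to `a`. -/
theorem exists_code_one_ebit [Nonempty R] {H : Matrix R N (ZMod 2)}
    (hH : H * H.transpose = Matrix.of fun _ _ => 1) (hinj : Function.Injective H.transpose.mulVec)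
    {k : ℕ} (hk : k + 2 * Fintype.card R = Fintype.card N + 1) :
    ∃ Q : Code N k 1, Q.DecodedBy H := by
  obtain ⟨κ, hκ, hκinj⟩ := exists_coset_representatives hH hinj hk
  have hker : ∀ a x, x ∈ rowCoset H (κ a) → checkMap H x = 0 := by
    intro a x hx
    obtain ⟨y, rfl⟩ := mem_rowCoset.1 hx
    rw [map_add, hκ, checkMap_rowMap hH, add_zero]
  have hdisj : ∀ a a' x, x ∈ rowCoset H (κ a) → x ∈ rowCoset H (κ a') → a = a' := by
    intro a a' x hx hx'
    obtain ⟨y, rfl⟩ := mem_rowCoset.1 hx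
    rw [add_rowMap_mem_rowCoset, mem_rowCoset] at hx'
    obtain ⟨y', hy'⟩ := hx'
    exact (hκinj a' a ⟨y', hy'⟩).symm
  set n : Bits (Fin k) → ℕ := fun a => #{x : Bits N | (x, 0) ∈ rowCoset H (κ a)} with hn
  have hncard : ∀ a j, #{x : Bits N | (x, j) ∈ rowCoset H (κ a)} = n a :=
    fun a j => card_rowCoset_slice H (κ a) j 0
  have hnpos : ∀ a, 0 < n a := fun a => by
    rw [← hncard a (κ a).2]
    exact card_pos.2 ⟨(κ a).1, by simpa using mem_rowCoset.2 ⟨0, by simp⟩⟩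
  set u : Bits (Fin k) × Bits (Fin 1) → Hilb (Bits N) := fun i =>
    WithLp.toLp 2 fun x => if (x, i.2) ∈ rowCoset H (κ i.1) then (((√(n i.1))⁻¹ : ℝ) : ℂ) else 0
    with hu
  have horth : Orthonormal ℂ u := by
    rw [orthonormal_iff_ite]
    rintro ⟨a, j⟩ ⟨a', j'⟩
    rw [PiLp.inner_apply]
    split_ifs with h
    · cases h
      have hsq : (((√(n a))⁻¹ : ℝ) : ℂ) * ((√(n a))⁻¹ : ℝ) = (n a : ℂ)⁻¹ := by
        rw [← Complex.ofReal_mul, ← mul_inv, Real.mul_self_sqrt (Nat.cast_nonneg _)]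
        simp
      have : ∀ x, inner ℂ (u (a, j) x) (u (a, j) x) =
          if (x, j) ∈ rowCoset H (κ a) then (n a : ℂ)⁻¹ else 0 := fun x => by
        simp only [hu, RCLike.inner_apply]
        split_ifs
        · rw [Complex.conj_ofReal, hsq]
        · simp
      rw [sum_congr rfl fun x _ => this x, ← sum_filter, sum_const, hncard, nsmul_eq_mul,
        mul_inv_cancel₀ (Nat.cast_ne_zero.2 (hnpos a).ne')]
    · refine sum_eq_zero fun x _ => ?_
      by_contra h0
      have h1 : (x, j) ∈ rowCoset H (κ a) := by
        by_contra hc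
        exact h0 (by simp [hu, hc])
      have h2 : (x, j') ∈ rowCoset H (κ a') := by
        by_contra hc
        exact h0 (by simp [hu, hc])
      -- `(x, j)` and `(x, j')` cannot both have syndrome zero unless `j = j'`
      have hj : j = j' := by
        have h3 := (hker a _ h1).trans (hker a' _ h2).symm
        simp only [checkMap_apply, add_right_inj] at h3
        have := congrFun h3 (Classical.arbitrary R)
        refine funext fun i => ?_
        rw [Fin.fin_one_eq_zero i]
        exact this
      subst hj
      exact h (by rw [hdisj a a' _ h1 h2])
  obtain ⟨f, hf⟩ := exists_linearIsometry_of_orthonormal horth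
  have henc : ∀ ψ p, Code.encode ⟨f⟩ ψ p = ∑ a, ψ a * ((1 / √2 : ℝ) : ℂ) *
      if p ∈ rowCoset H (κ a) then (((√(n a))⁻¹ : ℝ) : ℂ) else 0 := by
    intro ψ p
    rw [Code.encode, PiLp.toLp_apply, hf, WithLp.ofLp_sum, Finset.sum_apply,
      Fintype.sum_prod_type]
    refine sum_congr rfl fun a _ => ?_
    rw [sum_eq_single_of_mem p.2 (mem_univ _) fun j _ hj => by simp [ebits, hj]]
    simp [ebits, hu]
  have hstab : ∀ ψ, IsStabilized H (Code.encode ⟨f⟩ ψ) := fun ψ => by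
    refine ⟨fun p hp => ?_, fun y p => ?_⟩
    · rw [henc] at hp
      obtain ⟨a, -, ha⟩ := exists_ne_zero_of_sum_ne_zero hp
      refine hker a p ?_
      by_contra hc
      exact ha (by simp [hc])
    · simp only [henc, add_rowMap_mem_rowCoset]
  exact ⟨⟨f⟩, Code.decodedBy_of_orthogonal _ _ fun _ _ _ _ ψ ψ' hne =>
    (hstab ψ).inner_pauli_eq_zero (hstab ψ') hne⟩

end Encoder

end EAQ

theorem mainTheorem3 (m q : ℕ) (hm : Even m) (hm2 : 2 ≤ m) (hq : IsPrimePow q) (hodd : Odd q)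
    (F : Type*) [Field F] [Fintype F] (hF : Fintype.card F = q) :
    -- `b` is the number of lines and `k` the dimension of the quantum code
    ∃ b k : ℕ,
      (b : ℚ) = (q : ℚ) ^ (m - 1) * (((q : ℚ) ^ m - 1) / ((q : ℚ) - 1)) ∧
      (k : ℚ) = (b : ℚ) - (q : ℚ) ^ m - 1 ∧
      -- the number of physical qubits, which is also the length of the LDPC code
      Fintype.card (EAQ.Point F m ⊕ EAQ.Line F m) = b + q ^ m ∧
      -- one ebit suffices and is necessary
      IsLeast {c : ℕ | ∃ Q : EAQ.Code (EAQ.Point F m ⊕ EAQ.Line F m) k c,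
        Q.DecodedBy (EAQ.extMatrix F m)} 1 ∧
      (EAQ.extMatrix F m * (EAQ.extMatrix F m).transpose).rank = 1 ∧
      -- the dimension, girth and minimum distance of the LDPC code
      (Module.finrank (ZMod 2) (EAQ.code (EAQ.extMatrix F m)) : ℚ) = (b : ℚ) - 1 ∧
      (EAQ.tannerGraph (EAQ.extMatrix F m)).girth = 6 ∧
      EAQ.IsMinDist (EAQ.code (EAQ.extMatrix F m)) (2 * q) := by
  subst hF
  set q := Fintype.card F with hq'
  have hq1 : 1 < q := Fintype.one_lt_card
  set b := Fintype.card (EAQ.Line F m) with hb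
  set v := q ^ m with hv
  have hmul : b * q * (q - 1) = v * (v - 1) := EAQ.card_line_mul
  have hvq : q ^ 2 ≤ v := Nat.pow_le_pow_right (by omega) hm2
  have hv1 : 1 ≤ v := Nat.one_le_pow _ _ (by omega)
  have hbv : v + 1 ≤ b := by
    -- otherwise `q ^ 2 - 1 ≤ v - 1 ≤ q (q - 1)`
    by_contra! hlt
    have h1 : v * (v - 1) ≤ v * (q * (q - 1)) := by
      rw [← hmul, mul_assoc]
      exact Nat.mul_le_mul_right _ (by omega)
    have h2 := Nat.le_of_mul_le_mul_left h1 (by positivity)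
    rw [Nat.mul_sub, mul_one, ← sq] at h2
    have h3 : q ≤ q ^ 2 := Nat.le_self_pow (by norm_num) q
    omega
  have hvQ : (v : ℚ) = (q : ℚ) ^ m := by
    rw [hv]
    push_cast
    rfl
  have hcardN : Fintype.card (EAQ.Point F m ⊕ EAQ.Line F m) = b + v := by
    rw [Fintype.card_sum, add_comm]
    simp [hb, hv, hq']
  have hcardR : Fintype.card (EAQ.Point F m ⊕ Unit) = v + 1 := by
    simp [hv, hq']
  have hinj := EAQ.extMatrix_transpose_mulVec_injective (F := F) hodd (by omega : 1 ≤ m)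
  have hsurj : Function.Surjective (EAQ.extMatrix F m).mulVec := by
    have h := EAQ.rank_extMatrix (F := F) hodd (by omega : 1 ≤ m)
    rw [Matrix.rank] at h
    have h2 : LinearMap.range (EAQ.extMatrix F m).mulVecLin = ⊤ :=
      Submodule.eq_top_of_finrank_eq (by rw [h, Module.finrank_fintype_fun_eq_card, hcardR])
    exact LinearMap.range_eq_top.1 h2
  refine ⟨b, b - v - 1, ?_, ?_, hcardN, ⟨?_, ?_⟩, EAQ.rank_extMatrix_mul_transpose hm hodd, ?_,
    EAQ.girth_tannerGraph_extMatrix (by omega), EAQ.isMinDist_code_extMatrix hm2 hodd⟩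
  · have h1 : (q : ℚ) - 1 ≠ 0 := by
      have : (1 : ℚ) < q := by exact_mod_cast hq1
      exact (sub_pos.2 this).ne'
    have h0 : (q : ℚ) ≠ 0 := by positivity
    have h2 : (b : ℚ) * q * (q - 1) = (q : ℚ) ^ m * (q ^ m - 1) := by
      rw [← hvQ]
      have := congrArg (Nat.cast : ℕ → ℚ) hmul
      rwa [Nat.cast_mul, Nat.cast_mul, Nat.cast_mul, Nat.cast_sub hq1.le,
        Nat.cast_sub hv1, Nat.cast_one] at this
    have h3 : (q : ℚ) ^ m = q ^ (m - 1) * q := by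
      rw [← pow_succ, Nat.sub_add_cancel (by omega)]
    rw [← mul_div_assoc, eq_div_iff h1]
    apply mul_right_cancel₀ h0
    nth_rewrite 1 [h3] at h2
    linear_combination h2
  · rw [Nat.sub_sub, Nat.cast_sub hbv, ← hvQ]
    push_cast
    ring
  · exact EAQ.exists_code_one_ebit (EAQ.extMatrix_mul_transpose hm hodd) hinj
      (by rw [hcardN, hcardR]; omega)
  · rintro c ⟨Q, hQ⟩
    by_contra! hc
    obtain rfl : c = 0 := by omega
    have := hQ.add_two_mul_card_le hsurj
    rw [hcardN, hcardR] at this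
    omega
  · rw [hb, ← EAQ.finrank_code_extMatrix (F := F) hodd (by omega : 1 ≤ m)]
    push_cast
    ring
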